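/- **Setting.** Let $(\Lambda_n)_{n\ge 1}$ be a sequence of finite lattices: finite metric spaces of sites such that, for every $\ell$, the number of sites in a ball of radius $\ell$ is bounded uniformly in $n$ and in the center (in the thermodynamic limit, $|\Lambda_n|\to\infty$). Every site carries a copy of a fixed finite-dimensional Hilbert space $\mathbb{C}^{\kappa}$. Let $G$ be an Abelian group acting by on-site unitary representations, $U(g)=\bigotimes_{i\in\Lambda_n}u_{n,i}(g)$. An operator $O$ supported on a region is *charged*, with charge $\chi$, if $U(g)\,O\,U(g)^\dagger=\chi(g)\,O$ for all $g\in G$, where $\chi:G\to U(1)$ is a nontrivial character. For a density matrix $\rho$ on $\Lambda_n$ let $\rho_A$ be its reduced density matrix on the region $A\subseteq\Lambda_n$, let $F(\rho,\sigma)=\operatorname{Tr}\sqrt{\sqrt\rho\,\sigma\sqrt\rho}$, and for $O$ supported in $A$ put $F(\rho_A;O)=F(\rho_A,O\rho_AO^\dagger)$. A sequence of states $\rho_n$ on $\Lambda_n$ has *local (one-point fidelity) SW-SSB* at the sites $x_n\in\Lambda_n$ with charge $\chi$ if there are $R$, operators $O_n$ of charge $\chi$ supported in the ball of radius $R$ around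 $x_n$ with $\|O_n\|_\infty\le 1$, and a constant $c>0$ such that for every $\ell$, for all sufficiently large $n$, $$F\big((\rho_n)_A;O_n\big)\ \ge\ c\qquad\text{for all regions } A \text{ with } B(x_n,R)\subseteq A\subseteq B(x_n,\ell).$$ (That is, $F(\rho_A;O_x)$ stays bounded away from $0$ when first the system size and then the region $A$ becomes large.) A *finite-depth local channel* is a sequence of maps $$\mathcal{E}_n[\rho]=\operatorname{Tr}_a\big(U_n^\dagger\,(\rho\otimes|0\rangle\langle 0|_a)\,U_n\big),$$ where every site also carries an ancilla from a fixed finite-dimensional space, $|0\rangle_a$ is a product reference state of the ancillas, and $U_n$ is a unitary circuit on sites and ancillas with at most $D$ layers, each layer being a product of unitary gates with disjoint supports of diameter at most $r$, with $D$ and $r$ independent of $n$. It is *strongly symmetric* if every $\mathcal{E}_n$ has a Kraus representation $\mathcal{E}_n[\rho]=\sum_aK_a\rho K_a^\dagger$ in which every $K_a$ commutes with $U(g)$ for all $g\in G$. **Theorem 4 (stability).** If $(\rho_n)$ has local SW-SSB at the sites $x_n$ with charge $\chi$ and $(\mathcal{E}_n)$ is a strongly symmetric finite-depth local quantum channel,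 then $(\mathcal{E}_n[\rho_n])$ has local SW-SSB at the same sites with the same charge. In particular, local SW-SSB is preserved by every strongly symmetric finite-depth local quantum channel. -/

import Mathlib

open Filter
open scoped Matrix MatrixOrder ComplexOrder

namespace LocalSWSSB

/-! ### Finite quantum lattice systems

The Hilbert space of a finite set `ι` of sites, with `β` labelling an orthonormal basis at each
site, has the orthonormal basis `ι → β`.  Operators on it are matrices indexed by `ι → β`. -/

/-- Operators on the Hilbert space of the sites `ι` with local basis `β`. -/
abbrev Op (ι β : Type*) := Matrix (ι → β) (ι → β) ℂ

/-- `ρ` is a density matrix (a mixed state). -/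
def IsDensityMatrix {m : Type*} [Fintype m] (ρ : Matrix m m ℂ) : Prop :=
  ρ.PosSemidef ∧ ρ.trace = 1

open Classical in
/-- Regard an operator `M` on the sites `S` as the operator `M ⊗ 1` on the sites `T`,
along the inclusion `f : S ↪ T`. -/
noncomputable def embedOp {S T β : Type*} (f : S ↪ T) (M : Op S β) : Op T β :=
  Matrix.of fun s t => if ∀ j ∉ Set.range f, s j = t j then M (s ∘ f) (t ∘ f) else 0

open Classical in
/-- The partial trace over the sites of `T` outside the range of the inclusion `f : S ↪ T`. -/
noncomputable def partialTrace {S T β : Type*} [Fintype T] [Fintype β] (f : S ↪ T) (ρ : Op T β) : Op S β :=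
  Matrix.of fun s t => ∑ σ : T → β, ∑ τ : T → β,
    if σ ∘ f = s ∧ τ ∘ f = t ∧ ∀ j ∉ Set.range f, σ j = τ j then ρ σ τ else 0

/-- The reduced density matrix `ρ_A` of a state `ρ` of the whole system on a region `A`. -/
noncomputable def reduced {Λ κ : Type*} [Fintype Λ] [DecidableEq Λ] [Fintype κ] (A : Finset Λ)
    (ρ : Op Λ κ) : Op A κ :=
  partialTrace (Function.Embedding.subtype (· ∈ A)) ρ

/-- An operator on the region `S`, regarded as an operator on the larger region `A`. -/
noncomputable def extendOp {Λ κ : Type*} {S A : Finset Λ} (h : S ⊆ A) (M : Op S κ) : Op A κ :=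
  embedOp (Subtype.impEmbedding (· ∈ S) (· ∈ A) fun _ hx => h hx) M

/-- The fidelity `F(ρ, σ) = Tr √(√ρ σ √ρ)`. -/
noncomputable def fidelity {m : Type*} [Fintype m] [DecidableEq m] (ρ σ : Matrix m m ℂ) : ℝ :=
  (CFC.sqrt (CFC.sqrt ρ * σ * CFC.sqrt ρ)).trace.re

/-- The one-point local fidelity correlator `F(ρ_A; O) = F(ρ_A, O ρ_A O†)`, for an operator `O`
on the region `A`. -/
noncomputable def localFidelity {Λ κ : Type*} [Fintype Λ] [DecidableEq Λ] [Fintype κ]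
    [DecidableEq κ] (ρ : Op Λ κ) (A : Finset Λ) (O : Op A κ) : ℝ :=
  fidelity (reduced A ρ) (O * reduced A ρ * Oᴴ)

open scoped Matrix.Norms.L2Operator in
/-- The operator norm `‖M‖_∞` on the Hilbert space with orthonormal basis `m`. -/
noncomputable def opNorm {m : Type*} [Fintype m] [DecidableEq m] (M : Matrix m m ℂ) : ℝ := ‖M‖

/-- The ball of radius `R` around the site `x`. -/
noncomputable def ball {Λ : Type*} [Fintype Λ] [MetricSpace Λ] (x : Λ) (R : ℝ) : Finset Λ :=
  Finset.univ.filter fun y => dist y x ≤ R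

/-! ### On-site symmetry and charged operators -/

/-- The on-site symmetry operator `U(g) = ⨂ i, u i g` on the sites `ι`. -/
def symmetryOp {ι κ G : Type*} [Fintype ι] [Fintype κ] [DecidableEq κ] [Group G]
    (u : ι → G →* Matrix.unitaryGroup κ ℂ) (g : G) : Op ι κ :=
  Matrix.of fun s t => ∏ i, (u i g : Matrix κ κ ℂ) (s i) (t i)

/-- `O` is a charged operator, of the nontrivial charge `χ`: `U(g) O U(g)† = χ(g) O`. -/
def IsCharged {ι κ G : Type*} [Fintype ι] [DecidableEq ι] [Fintype κ] [DecidableEq κ] [Group G]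
    (u : ι → G →* Matrix.unitaryGroup κ ℂ) (χ : G →* Circle) (O : Op ι κ) : Prop :=
  χ ≠ 1 ∧ ∀ g : G, symmetryOp u g * O * (symmetryOp u g)ᴴ = (χ g : ℂ) • O

/-! ### Local SW-SSB -/

/-- A sequence of mixed states `ρ n` of finite systems `Λ n` has local (one-point fidelity) SW-SSB
at the sites `x n`, with charge `χ`: there are local charged operators `O n` near `x n`
(of range `R` and norm at most one, uniformly in `n`) and a constant `c > 0` such that at every
fixed length scale `ℓ`, once the system is large enough, `F(ρ_A; O) ≥ c` for all the regions `A`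
of size at most `ℓ` around `x n` that contain the support of `O n`.  The limit of large systems
is thus taken before the limit of large regions. -/
def HasLocalSWSSB {Λ : ℕ → Type*} [∀ n, Fintype (Λ n)] [∀ n, DecidableEq (Λ n)]
    [∀ n, MetricSpace (Λ n)] {κ G : Type*} [Fintype κ] [DecidableEq κ] [Group G]
    (u : ∀ n, Λ n → G →* Matrix.unitaryGroup κ ℂ) (χ : G →* Circle) (x : ∀ n, Λ n)
    (ρ : ∀ n, Op (Λ n) κ) : Prop :=
  ∃ (R : ℝ) (O : ∀ n, Op (ball (x n) R) κ),
    (∀ n, IsCharged (fun i : ball (x n) R => u n i) χ (O n)) ∧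
    (∀ n, opNorm (O n) ≤ 1) ∧
    ∃ c : ℝ, 0 < c ∧ ∀ ℓ : ℝ, ∀ᶠ n in atTop, ∀ (A : Finset (Λ n)) (h : ball (x n) R ⊆ A),
      A ⊆ ball (x n) ℓ → c ≤ localFidelity (ρ n) A (extendOp h (O n))

/-! ### Finite-depth local circuits and channels -/

/-- A unitary gate acting on the sites of a finite set `support`. -/
structure Gate (Λ β : Type*) [DecidableEq Λ] [Fintype β] [DecidableEq β] where
  /-- The sites on which the gate acts. -/
  support : Finset Λ
  /-- The operator that the gate applies. -/
  op : Op support β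
  /-- The gate is unitary. -/
  unitary : op ∈ Matrix.unitaryGroup (support → β) ℂ

/-- `W` is one layer of a circuit: a product of gates with pairwise disjoint supports, each of
diameter at most `r`. -/
def IsLayer {Λ β : Type*} [Fintype Λ] [DecidableEq Λ] [MetricSpace Λ] [Fintype β] [DecidableEq β]
    (r : ℝ) (W : Op Λ β) : Prop :=
  ∃ gates : List (Gate Λ β),
    gates.Pairwise (fun a b => Disjoint a.support b.support) ∧
    (∀ a ∈ gates, ∀ y ∈ a.support, ∀ z ∈ a.support, dist y z ≤ r) ∧
    W = (gates.map fun a => embedOp (Function.Embedding.subtype (· ∈ a.support)) a.op).prod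

/-- `U` is a local unitary circuit of depth at most `D` with gates of range at most `r`. -/
def IsCircuit {Λ β : Type*} [Fintype Λ] [DecidableEq Λ] [MetricSpace Λ] [Fintype β]
    [DecidableEq β] (r : ℝ) (D : ℕ) (U : Op Λ β) : Prop :=
  ∃ layers : List (Op Λ β), layers.length ≤ D ∧ (∀ W ∈ layers, IsLayer r W) ∧ U = layers.prod

open Classical in
/-- `ρ ⊗ |0⟩⟨0|_a`, where every site carries an ancilla with local basis `α`, and `|0⟩_a` is the
product state in which all the ancillas are in the basis state `a₀`. -/
noncomputable def withAncilla {Λ κ α : Type*} (a₀ : α) (ρ : Op Λ κ) : Op Λ (κ × α) :=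
  Matrix.of fun s t => if ∀ i, (s i).2 = a₀ ∧ (t i).2 = a₀ then
    ρ (fun i => (s i).1) (fun i => (t i).1) else 0

/-- The partial trace over the ancillas. -/
def traceAncilla {Λ κ α : Type*} [Fintype Λ] [DecidableEq Λ] [Fintype α]
    (M : Op Λ (κ × α)) : Op Λ κ :=
  Matrix.of fun s t => ∑ a : Λ → α, M (fun i => (s i, a i)) (fun i => (t i, a i))

/-- `E` is a local quantum channel of depth at most `D`:
`E[ρ] = Tr_a (U† (ρ ⊗ |0⟩⟨0|_a) U)` for a local unitary circuit `U` of depth at most `D`, with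
gates of range at most `r`, acting on the system and the ancillas. -/
def IsFiniteDepthChannel {Λ κ α : Type*} [Fintype Λ] [DecidableEq Λ] [MetricSpace Λ] [Fintype κ]
    [DecidableEq κ] [Fintype α] [DecidableEq α] (a₀ : α) (r : ℝ) (D : ℕ)
    (E : Op Λ κ → Op Λ κ) : Prop :=
  ∃ U : Op Λ (κ × α), IsCircuit r D U ∧ ∀ ρ, E ρ = traceAncilla (Uᴴ * withAncilla a₀ ρ * U)

/-- `E` is strongly symmetric: it has a Kraus representation in which every Kraus operator
commutes with the symmetry. -/
def IsStronglySymmetric {Λ κ G : Type*} [Fintype Λ] [DecidableEq Λ] [Fintype κ] [DecidableEq κ]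
    [Group G] (u : Λ → G →* Matrix.unitaryGroup κ ℂ) (E : Op Λ κ → Op Λ κ) : Prop :=
  ∃ (m : ℕ) (K : Fin m → Op Λ κ), (∀ ρ, E ρ = ∑ a, K a * ρ * (K a)ᴴ) ∧
    ∀ a g, K a * symmetryOp u g = symmetryOp u g * K a

end LocalSWSSB

/-! Write `K_c = ⟨c|U†|a₀⟩` for the Kraus operators of the Stinespring circuit, and let `O` be the
charged operator of the input. By the light cone, `X = U†(O ⊗ 1)U` acts only on the ball `B` of
radius `R + D * max r 0` and on the ancillas there. Inserting a resolution of the identity over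
these ancillas gives `K_(a,c) O = ∑_b F_ab K_(b,c)` with `F_ab = ⟨a|X|b⟩` acting on `B`. The number
`N` of ancilla configurations of `B` is bounded uniformly in the system size. Operator
Cauchy–Schwarz then gives `E[OρO†] ≤ N ∑ F_ab E[ρ] F_ab†` (`posSemidef_kraus_conj_sub`). The
fidelity does not decrease under the local channel when the ball shrinks by the light-cone width
(`fidelity_reduced_le_channel`), and it is monotone and subadditive in its second argument. So the
input correlator is at most `N` times the sum of the `N²` output correlators
(`localFidelity_le_sum`), and one of these is at least `c / N³`.

These `F_ab` need not be charged, because only the Kraus operators, and not `U`, are symmetric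
(`kraus_commute`). However, the contractive solutions of the intertwining relation form a compact
convex set, preserved by the Hilbert–Schmidt isometries `F ↦ χ(g)* U(g) F U(g)†`. The solution of
least Hilbert–Schmidt norm is fixed by all of them, hence charged (`exists_charged_family`). This
replaces averaging over the group, which carries no topology or measure here.

Finally, the winning pair `(a, b)` depends on the region, whereas the output operator must serve
every length scale. Local fidelities decrease as the region grows, so an operator selected at the
largest integer scale `m ≤ n` on which the input is good works on all smaller regions
(`exists_charged_output`). -/

namespace LocalSWSSB

set_option linter.unusedSectionVars false

/-! ### Fidelity: purifications, monotonicity and subadditivity -/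

section Fidelity

variable {m n p q ι : Type*} [Fintype m] [DecidableEq m] [Fintype n] [DecidableEq n]
  [Fintype p] [DecidableEq p] [Fintype q] [DecidableEq q] [Fintype ι] [DecidableEq ι]

theorem norm_toEuclideanLin_sq (A : Matrix p n ℂ) (v : EuclideanSpace ℂ n) :
    ((‖Matrix.toEuclideanLin A v‖ ^ 2 : ℝ) : ℂ) = star v.ofLp ⬝ᵥ ((Aᴴ * A) *ᵥ v.ofLp) := by
  rw [← Matrix.mulVec_mulVec, Matrix.dotProduct_mulVec, ← Matrix.star_mulVec]
  have := inner_self_eq_norm_sq_to_K (𝕜 := ℂ) (Matrix.toEuclideanLin A v)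
  rw [EuclideanSpace.inner_eq_star_dotProduct] at this
  rw [dotProduct_comm]
  simpa using this.symm

/-- Matrices with the same Gram matrix differ by a unitary. -/
theorem exists_unitary_of_gram_eq {A B : Matrix p n ℂ} (h : Aᴴ * A = Bᴴ * B) :
    ∃ U ∈ Matrix.unitaryGroup p ℂ, A = U * B := by
  set f := Matrix.toEuclideanLin (𝕜 := ℂ) A with hf
  set g := Matrix.toEuclideanLin (𝕜 := ℂ) B with hg
  have hn : ∀ v, ‖f v‖ = ‖g v‖ := by
    intro v
    have h1 : ‖f v‖ ^ 2 = ‖g v‖ ^ 2 := by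
      have := norm_toEuclideanLin_sq A v
      rw [h, ← norm_toEuclideanLin_sq B v] at this
      exact_mod_cast this
    exact (sq_eq_sq₀ (norm_nonneg _) (norm_nonneg _)).1 h1
  have hk : LinearMap.ker g ≤ LinearMap.ker f := by
    intro v hv
    rw [LinearMap.mem_ker] at hv ⊢
    rw [← norm_eq_zero, hn, hv, norm_zero]
  -- The map `B v ↦ A v` is well defined and isometric on the range of `B`; in finite dimension it
  -- extends to the whole space.
  let L₀ : LinearMap.range g →ₗ[ℂ] EuclideanSpace ℂ p :=
    (LinearMap.ker g).liftQ f hk ∘ₗ g.quotKerEquivRange.symm.toLinearMap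
  have hL₀ : ∀ v, L₀ ⟨g v, LinearMap.mem_range_self g v⟩ = f v := by
    intro v
    simp [L₀, LinearMap.quotKerEquivRange_symm_apply_image]
  let L : LinearMap.range g →ₗᵢ[ℂ] EuclideanSpace ℂ p :=
    { L₀ with
      norm_map' := by
        rintro ⟨_, v, rfl⟩
        change ‖L₀ _‖ = ‖g v‖
        rw [hL₀, hn] }
  have hL : ∀ v, L.extend (g v) = f v := fun v => by
    rw [← hL₀ v]
    exact L.extend_apply ⟨g v, LinearMap.mem_range_self g v⟩
  set U : Matrix p p ℂ := Matrix.toEuclideanLin.symm L.extend.toLinearMap with hU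
  have hUL : ∀ v, Matrix.toEuclideanLin U v = L.extend v := fun v => by simp [hU]
  refine ⟨U, ?_, ?_⟩
  · rw [Matrix.mem_unitaryGroup_iff', Matrix.star_eq_conjTranspose]
    apply (Matrix.toEuclideanLin (𝕜 := ℂ)).injective
    refine LinearMap.ext fun v => ?_
    refine ext_inner_left ℂ fun w => ?_
    have h2 : inner ℂ (Matrix.toEuclideanLin U w) (Matrix.toEuclideanLin U v) = inner ℂ w v := by
      rw [hUL, hUL, LinearIsometry.inner_map_map]
    rw [← LinearMap.adjoint_inner_right, ← Matrix.toEuclideanLin_conjTranspose_eq_adjoint] at h2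
    simpa [Matrix.toLpLin_apply, Matrix.mulVec_mulVec] using h2
  · apply (Matrix.toEuclideanLin (𝕜 := ℂ)).injective
    refine LinearMap.ext fun v => ?_
    rw [← hf, ← hL v, ← hUL, hg]
    simp [Matrix.toLpLin_apply, Matrix.mulVec_mulVec]

/-- `C` is a contraction for the `ℓ²` operator norm. -/
def IsContraction (C : Matrix p q ℂ) : Prop := (1 - Cᴴ * C).PosSemidef

theorem IsContraction.mul {C : Matrix m p ℂ} {D : Matrix p q ℂ} (hC : IsContraction C)
    (hD : IsContraction D) : IsContraction (C * D) := by
  have h := hD.add (hC.conjTranspose_mul_mul_same D)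
  unfold IsContraction
  convert h using 1
  simp [Matrix.mul_sub, Matrix.sub_mul, Matrix.mul_assoc]

theorem isContraction_of_isometry {V : Matrix p q ℂ} (h : Vᴴ * V = 1) : IsContraction V := by
  unfold IsContraction
  rw [h, sub_self]
  exact Matrix.PosSemidef.zero

theorem isContraction_conjTranspose_of_isometry {V : Matrix p q ℂ} (h : Vᴴ * V = 1) :
    IsContraction Vᴴ := by
  unfold IsContraction
  have h2 : (1 - V * Vᴴ)ᴴ * (1 - V * Vᴴ) = 1 - V * Vᴴ := by
    have : V * Vᴴ * (V * Vᴴ) = V * Vᴴ := by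
      rw [Matrix.mul_assoc, ← Matrix.mul_assoc Vᴴ, h, Matrix.one_mul]
    simp [Matrix.mul_sub, Matrix.sub_mul, this]
  rw [Matrix.conjTranspose_conjTranspose, ← h2]
  exact Matrix.posSemidef_conjTranspose_mul_self _

/-- Rectangular form of `exists_unitary_of_gram_eq`. -/
theorem exists_contraction_of_gram_eq {A : Matrix p n ℂ} {B : Matrix q n ℂ}
    (h : Aᴴ * A = Bᴴ * B) :
    ∃ C : Matrix p q ℂ, IsContraction C ∧ IsContraction Cᴴ ∧ A = C * B := by
  -- Zero padding in complementary blocks gives `A` and `B` the same height; an off-diagonal block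
  -- of the resulting unitary is the contraction.
  have hg : (Matrix.fromRows A (0 : Matrix q n ℂ))ᴴ * Matrix.fromRows A (0 : Matrix q n ℂ)
      = (Matrix.fromRows (0 : Matrix p n ℂ) B)ᴴ * Matrix.fromRows (0 : Matrix p n ℂ) B := by
    simp [Matrix.conjTranspose_fromRows_eq_fromCols_conjTranspose, Matrix.fromCols_mul_fromRows, h]
  obtain ⟨U, hU, hAB⟩ := exists_unitary_of_gram_eq hg
  rw [Matrix.mem_unitaryGroup_iff', Matrix.star_eq_conjTranspose] at hU
  let P : Matrix (p ⊕ q) p ℂ := Matrix.fromRows 1 0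
  let R : Matrix (p ⊕ q) q ℂ := Matrix.fromRows 0 1
  have hP : Pᴴ * P = 1 := by
    simp [P, Matrix.conjTranspose_fromRows_eq_fromCols_conjTranspose,
      Matrix.fromCols_mul_fromRows]
  have hR : Rᴴ * R = 1 := by
    simp [R, Matrix.conjTranspose_fromRows_eq_fromCols_conjTranspose,
      Matrix.fromCols_mul_fromRows]
  have hU' : (Uᴴ)ᴴ * Uᴴ = 1 := by
    rw [Matrix.conjTranspose_conjTranspose, mul_eq_one_comm, hU]
  refine ⟨Pᴴ * (U * R), ?_, ?_, ?_⟩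
  · exact (isContraction_conjTranspose_of_isometry hP).mul
      ((isContraction_of_isometry hU).mul (isContraction_of_isometry hR))
  · rw [Matrix.conjTranspose_mul, Matrix.conjTranspose_mul, Matrix.conjTranspose_conjTranspose]
    exact ((isContraction_conjTranspose_of_isometry hR).mul (isContraction_of_isometry hU')).mul
      (isContraction_of_isometry hP)
  · have h1 : Pᴴ * Matrix.fromRows A (0 : Matrix q n ℂ) = A := by
      simp [P, Matrix.conjTranspose_fromRows_eq_fromCols_conjTranspose,
        Matrix.fromCols_mul_fromRows]
    have h2 : R * B = Matrix.fromRows (0 : Matrix p n ℂ) B := by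
      simp [R, Matrix.fromRows_mul]
    rw [Matrix.mul_assoc, Matrix.mul_assoc, h2, ← hAB, h1]

theorem sqrt_isHermitian (ρ : Matrix n n ℂ) : (CFC.sqrt ρ)ᴴ = CFC.sqrt ρ :=
  (Matrix.nonneg_iff_posSemidef.1 (CFC.sqrt_nonneg ρ)).isHermitian

theorem sqrt_posSemidef (ρ : Matrix n n ℂ) : (CFC.sqrt ρ).PosSemidef :=
  Matrix.nonneg_iff_posSemidef.1 (CFC.sqrt_nonneg ρ)

theorem sqrt_mul_sqrt {ρ : Matrix n n ℂ} (h : ρ.PosSemidef) : CFC.sqrt ρ * CFC.sqrt ρ = ρ :=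
  CFC.sqrt_mul_sqrt_self ρ (Matrix.nonneg_iff_posSemidef.2 h)

theorem trace_re_nonneg {Q : Matrix n n ℂ} (h : Q.PosSemidef) : 0 ≤ Q.trace.re :=
  (Complex.le_def.1 h.trace_nonneg).1

theorem re_trace_conjTranspose (A : Matrix n n ℂ) : Aᴴ.trace.re = A.trace.re := by
  simp [Matrix.trace_conjTranspose]

/-- With `S = √Q`, add the traces of the two positive matrices `S(1 - C†C)S` and `(S - CS)†(S -
CS)`: the quartic terms cancel. -/
theorem re_trace_contraction_mul_le {C Q : Matrix n n ℂ} (hC : IsContraction C)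
    (hQ : Q.PosSemidef) : (C * Q).trace.re ≤ Q.trace.re := by
  set S := CFC.sqrt Q with hS
  have hSS : S * S = Q := sqrt_mul_sqrt hQ
  have hSh : Sᴴ = S := sqrt_isHermitian Q
  have h1 := trace_re_nonneg (hC.mul_mul_conjTranspose_same S)
  have h2 := trace_re_nonneg (Matrix.posSemidef_conjTranspose_mul_self (S - C * S))
  have h3 : (S * C * S).trace = (C * Q).trace := by
    rw [Matrix.trace_mul_comm, ← Matrix.mul_assoc, hSS, Matrix.trace_mul_comm]
  have h4 : (S * Cᴴ * S).trace.re = (C * Q).trace.re := by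
    rw [← h3, ← re_trace_conjTranspose (S * C * S)]
    simp [hSh, Matrix.mul_assoc]
  have e1 : S * (1 - Cᴴ * C) * Sᴴ = Q - S * Cᴴ * C * S := by
    rw [hSh, Matrix.mul_sub, Matrix.sub_mul, Matrix.mul_one, hSS, Matrix.mul_assoc S Cᴴ C]
  have e2 : (S - C * S)ᴴ * (S - C * S) = Q - S * C * S - S * Cᴴ * S + S * Cᴴ * C * S := by
    rw [Matrix.conjTranspose_sub, Matrix.conjTranspose_mul, hSh, ← hSS]
    noncomm_ring
  rw [e1] at h1
  rw [e2] at h2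
  simp only [Matrix.trace_sub, Matrix.trace_add, Complex.sub_re, Complex.add_re, h3, h4] at h1 h2
  linarith

/-- Purifications bound the fidelity from below. -/
theorem re_trace_le_fidelity (L K : Matrix n q ℂ) :
    (L * Kᴴ).trace.re ≤ fidelity (L * Lᴴ) (K * Kᴴ) := by
  have hL : (L * Lᴴ).PosSemidef := Matrix.posSemidef_self_mul_conjTranspose L
  set S := CFC.sqrt (L * Lᴴ) with hS
  have hSS : S * S = L * Lᴴ := sqrt_mul_sqrt hL
  have hSh : Sᴴ = S := sqrt_isHermitian _
  have hT : (S * (K * Kᴴ) * S).PosSemidef := by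
    have := (Matrix.posSemidef_self_mul_conjTranspose K).mul_mul_conjTranspose_same S
    rwa [hSh] at this
  set Q := CFC.sqrt (S * (K * Kᴴ) * S) with hQ
  -- Polar decompositions of `Lᴴ` and of `Kᴴ * S` turn the overlap into the trace of a contraction
  -- times `Q`, and the trace of `Q` is the fidelity.
  obtain ⟨C, hC, -, hLC⟩ := exists_contraction_of_gram_eq (A := Lᴴ) (B := S)
    (by rw [Matrix.conjTranspose_conjTranspose, hSh, hSS])
  obtain ⟨D, -, hD, hKD⟩ := exists_contraction_of_gram_eq (A := Kᴴ * S) (B := Q) (by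
    rw [sqrt_isHermitian, sqrt_mul_sqrt hT, Matrix.conjTranspose_mul, hSh,
      Matrix.conjTranspose_conjTranspose]
    simp only [Matrix.mul_assoc])
  have h1 : (L * Kᴴ).trace.re = (Dᴴ * C * Q).trace.re := by
    have e : (K * Lᴴ).trace = (Dᴴ * C * Q).trace := by
      have hSK : S * K = Q * Dᴴ := by
        have := congrArg Matrix.conjTranspose hKD
        rwa [Matrix.conjTranspose_mul, Matrix.conjTranspose_mul, hSh,
          Matrix.conjTranspose_conjTranspose, sqrt_isHermitian] at this
      rw [hLC, Matrix.trace_mul_comm, Matrix.mul_assoc, hSK, ← Matrix.mul_assoc,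
        Matrix.trace_mul_comm, Matrix.mul_assoc]
    rw [← re_trace_conjTranspose, Matrix.conjTranspose_mul, Matrix.conjTranspose_conjTranspose, e]
  rw [h1]
  exact re_trace_contraction_mul_le (hD.mul hC) (sqrt_posSemidef _)

/-- Uhlmann's theorem: the fidelity is attained by some purifications. -/
theorem exists_purification {ρ σ : Matrix n n ℂ} (hρ : ρ.PosSemidef) (hσ : σ.PosSemidef) :
    ∃ L K : Matrix n n ℂ, L * Lᴴ = ρ ∧ K * Kᴴ = σ ∧ (L * Kᴴ).trace.re = fidelity ρ σ := by
  have hT : (CFC.sqrt ρ * σ * CFC.sqrt ρ).PosSemidef := by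
    have := hσ.mul_mul_conjTranspose_same (CFC.sqrt ρ)
    rwa [sqrt_isHermitian] at this
  obtain ⟨U, hU, hQ⟩ := exists_unitary_of_gram_eq
    (A := CFC.sqrt (CFC.sqrt ρ * σ * CFC.sqrt ρ)) (B := CFC.sqrt σ * CFC.sqrt ρ) (by
      rw [sqrt_isHermitian, sqrt_mul_sqrt hT, Matrix.conjTranspose_mul, sqrt_isHermitian,
        sqrt_isHermitian, ← Matrix.mul_assoc, Matrix.mul_assoc (CFC.sqrt ρ) (CFC.sqrt σ),
        sqrt_mul_sqrt hσ])
  rw [Matrix.mem_unitaryGroup_iff, Matrix.star_eq_conjTranspose] at hU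
  refine ⟨CFC.sqrt ρ * U, CFC.sqrt σ, ?_, ?_, ?_⟩
  · rw [Matrix.conjTranspose_mul, sqrt_isHermitian, Matrix.mul_assoc, ← Matrix.mul_assoc U, hU,
      Matrix.one_mul, sqrt_mul_sqrt hρ]
  · rw [sqrt_isHermitian, sqrt_mul_sqrt hσ]
  · rw [fidelity, hQ, sqrt_isHermitian, Matrix.mul_assoc, Matrix.trace_mul_comm, Matrix.mul_assoc]

/-- Monotonicity of the fidelity under trace-preserving Kraus maps. -/
theorem fidelity_le_kraus {ρ σ : Matrix n n ℂ} (hρ : ρ.PosSemidef) (hσ : σ.PosSemidef)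
    (K : ι → Matrix m n ℂ) (hK : ∑ i, (K i)ᴴ * K i = 1) :
    fidelity ρ σ ≤ fidelity (∑ i, K i * ρ * (K i)ᴴ) (∑ i, K i * σ * (K i)ᴴ) := by
  obtain ⟨A, B, hA, hB, hAB⟩ := exists_purification hρ hσ
  -- Placing the `K i * A` side by side purifies the output; trace preservation keeps the overlap of
  -- two such purifications unchanged.
  let stack : Matrix n n ℂ → Matrix m (ι × n) ℂ := fun A => Matrix.of fun s x => (K x.1 * A) s x.2
  have hstack : ∀ A B, stack A * (stack B)ᴴ = ∑ i, K i * (A * Bᴴ) * (K i)ᴴ := by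
    intro A B
    have : ∀ i, K i * (A * Bᴴ) * (K i)ᴴ = (K i * A) * (K i * B)ᴴ := fun i => by
      rw [Matrix.conjTranspose_mul]
      simp only [Matrix.mul_assoc]
    simp only [this]
    ext s t
    rw [Matrix.sum_apply, Matrix.mul_apply, Fintype.sum_prod_type]
    simp only [stack, Matrix.of_apply, Matrix.conjTranspose_apply]
    exact Finset.sum_congr rfl fun i _ => by rw [Matrix.mul_apply]; rfl
  have h := re_trace_le_fidelity (stack A) (stack B)
  rw [hstack, hstack, hstack, hA, hB] at h
  rw [← hAB]
  refine le_of_eq_of_le ?_ h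
  rw [Matrix.trace_sum]
  simp only [Matrix.mul_assoc (K _), Matrix.trace_mul_comm (K _)]
  rw [← Matrix.trace_sum]
  simp only [Matrix.mul_assoc (A * Bᴴ)]
  rw [← Matrix.mul_sum, hK, Matrix.mul_one]

/-- The column of the blocks `√(T i)` has Gram matrix `∑ T i`, so `√(∑ T i) = ∑ C_i √(T i)`, where
each block `C_i` of a contraction is again a contraction. -/
theorem trace_sqrt_sum_le (T : ι → Matrix n n ℂ) (hT : ∀ i, (T i).PosSemidef) :
    (CFC.sqrt (∑ i, T i)).trace.re ≤ ∑ i, (CFC.sqrt (T i)).trace.re := by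
  let B : Matrix (ι × n) n ℂ := Matrix.of fun x t => CFC.sqrt (T x.1) x.2 t
  have hB : ∀ C : Matrix n (ι × n) ℂ,
      C * B = ∑ i, (C.submatrix id (Prod.mk i)) * CFC.sqrt (T i) := by
    intro C
    ext s t
    rw [Matrix.sum_apply, Matrix.mul_apply, Fintype.sum_prod_type]
    exact Finset.sum_congr rfl fun i _ => by rw [Matrix.mul_apply]; rfl
  have hsum : (∑ i, T i).PosSemidef := Matrix.posSemidef_sum _ fun i _ => hT i
  obtain ⟨C, hC, -, hAC⟩ := exists_contraction_of_gram_eq (A := CFC.sqrt (∑ i, T i)) (B := B) (by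
    rw [sqrt_isHermitian, sqrt_mul_sqrt hsum, hB]
    refine Finset.sum_congr rfl fun i _ => ?_
    have : Bᴴ.submatrix id (Prod.mk i) = (CFC.sqrt (T i))ᴴ := rfl
    rw [this, sqrt_isHermitian, sqrt_mul_sqrt (hT i)])
  rw [hAC, hB, Matrix.trace_sum, Complex.re_sum]
  refine Finset.sum_le_sum fun i _ => re_trace_contraction_mul_le ?_ (sqrt_posSemidef _)
  have := hC.submatrix (Prod.mk i)
  unfold IsContraction
  convert this using 1
  ext s t
  simp [Matrix.mul_apply, Matrix.one_apply]

theorem fidelity_sum_le {ρ : Matrix n n ℂ} (σ : ι → Matrix n n ℂ)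
    (hσ : ∀ i, (σ i).PosSemidef) : fidelity ρ (∑ i, σ i) ≤ ∑ i, fidelity ρ (σ i) := by
  unfold fidelity
  rw [Matrix.mul_sum, Matrix.sum_mul]
  refine trace_sqrt_sum_le _ fun i => ?_
  have := (hσ i).mul_mul_conjTranspose_same (CFC.sqrt ρ)
  rwa [sqrt_isHermitian] at this

/-- The true factor is `√N`, but any bound depending on `N` alone suffices. -/
theorem fidelity_nsmul_le {ρ σ : Matrix n n ℂ} (hσ : σ.PosSemidef) (N : ℕ) :
    fidelity ρ (N • σ) ≤ N * fidelity ρ σ := by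
  have := fidelity_sum_le (ρ := ρ) (fun _ : Fin N => σ) fun _ => hσ
  simpa using this

open scoped Matrix.Norms.L2Operator in
theorem sqrt_mono {S T : Matrix n n ℂ} (h : S ≤ T) : CFC.sqrt S ≤ CFC.sqrt T :=
  CFC.sqrt_le_sqrt S T h

/-- The square root is operator monotone. This transfers the domination of the channel output to
fidelities. -/
theorem fidelity_mono {ρ σ τ : Matrix n n ℂ} (h : (τ - σ).PosSemidef) :
    fidelity ρ σ ≤ fidelity ρ τ := by
  unfold fidelity
  have h1 : CFC.sqrt ρ * σ * CFC.sqrt ρ ≤ CFC.sqrt ρ * τ * CFC.sqrt ρ := by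
    rw [Matrix.le_iff, ← Matrix.sub_mul, ← Matrix.mul_sub]
    have := h.mul_mul_conjTranspose_same (CFC.sqrt ρ)
    rwa [sqrt_isHermitian] at this
  have h2 := trace_re_nonneg (Matrix.le_iff.1 (sqrt_mono h1))
  rw [Matrix.trace_sub, Complex.sub_re] at h2
  linarith

end Fidelity

/-! ### Tensor factorizations through the isometries `v ↦ v ⊗ |c⟩` -/

section Legs

variable {m n k : Type*} [Fintype m] [DecidableEq m] [Fintype n] [DecidableEq n] [Fintype k]

open Classical in
/-- The isometry `ℂⁿ → ℂᵐ ≃ ℂⁿ ⊗ ℂᵏ`, `v ↦ v ⊗ |c⟩`. -/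
noncomputable def leg (e : m ≃ n × k) (c : k) : Matrix m n ℂ :=
  Matrix.of fun s t => if e s = (t, c) then 1 else 0

theorem leg_mul_apply {l : Type*} [DecidableEq k] (e : m ≃ n × k) (c : k) (M : Matrix n l ℂ) (s : m) (t : l) :
    (leg e c * M) s t = if (e s).2 = c then M (e s).1 t else 0 := by
  classical
  rw [Matrix.mul_apply, Finset.sum_eq_single (e s).1]
  · simp only [leg, Matrix.of_apply, Prod.ext_iff, true_and, ite_mul, one_mul, zero_mul]
  · intro b _ hb
    simp [leg, Prod.ext_iff, Ne.symm hb]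
  · simp

theorem mul_leg_conjTranspose_apply {l : Type*} [DecidableEq k] (e : m ≃ n × k) (c : k) (M : Matrix l n ℂ)
    (s : l) (t : m) :
    (M * (leg e c)ᴴ) s t = if (e t).2 = c then M s (e t).1 else 0 := by
  have := congrArg star (leg_mul_apply e c Mᴴ t s)
  rw [← Matrix.conjTranspose_apply, Matrix.conjTranspose_mul,
    Matrix.conjTranspose_conjTranspose] at this
  rw [this]
  split_ifs <;> simp

theorem leg_conjTranspose_mul_apply {l : Type*} (e : m ≃ n × k) (c : k) (X : Matrix m l ℂ)
    (s : n) (t : l) : ((leg e c)ᴴ * X) s t = X (e.symm (s, c)) t := by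
  classical
  rw [Matrix.mul_apply, Finset.sum_eq_single (e.symm (s, c))]
  · simp [leg]
  · intro b _ hb
    have : e b ≠ (s, c) := fun h => hb (by rw [← h, Equiv.symm_apply_apply])
    simp [leg, this]
  · simp

theorem mul_leg_apply {l : Type*} (e : m ≃ n × k) (c : k) (X : Matrix l m ℂ)
    (s : l) (t : n) : (X * leg e c) s t = X s (e.symm (t, c)) := by
  have := congrArg star (leg_conjTranspose_mul_apply e c Xᴴ t s)
  rw [← Matrix.conjTranspose_apply, Matrix.conjTranspose_mul,
    Matrix.conjTranspose_conjTranspose, Matrix.conjTranspose_conjTranspose] at this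
  simpa using this

theorem leg_conjTranspose_mul_leg (e : m ≃ n × k) (c : k) : (leg e c)ᴴ * leg e c = 1 := by
  ext s t
  rw [leg_conjTranspose_mul_apply]
  simp [leg, Matrix.one_apply, Prod.ext_iff]

theorem leg_conjTranspose_mul_leg_of_ne (e : m ≃ n × k) {c d : k} (h : c ≠ d) :
    (leg e c)ᴴ * leg e d = 0 := by
  ext s t
  rw [leg_conjTranspose_mul_apply]
  simp [leg, Prod.ext_iff, h]

theorem sum_leg_mul_mul_apply (e : m ≃ n × k) (M : Matrix n n ℂ) (s t : m) [DecidableEq k] :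
    (∑ c, leg e c * M * (leg e c)ᴴ) s t = if (e s).2 = (e t).2 then M (e s).1 (e t).1 else 0 := by
  rw [Matrix.sum_apply]
  simp only [mul_leg_conjTranspose_apply, leg_mul_apply]
  rw [Finset.sum_eq_single (e t).2]
  · simp
  · intro b _ hb
    simp [Ne.symm hb]
  · simp

theorem sum_leg_mul_leg_conjTranspose (e : m ≃ n × k) : ∑ c, leg e c * (leg e c)ᴴ = 1 := by
  classical
  ext s t
  have := sum_leg_mul_mul_apply e 1 s t
  simp only [Matrix.mul_one] at this
  rw [this, Matrix.one_apply, Matrix.one_apply]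
  by_cases h : s = t
  · simp [h]
  · have : e s ≠ e t := fun h' => h (e.injective h')
    rw [Ne, Prod.ext_iff, not_and] at this
    by_cases h1 : (e s).1 = (e t).1
    · simp [h, this h1]
    · simp [h, h1]

theorem sum_leg_mul_mul_leg (e : m ≃ n × k) (M : Matrix n n ℂ) (c : k) :
    (∑ d, leg e d * M * (leg e d)ᴴ) * leg e c = leg e c * M := by
  rw [Matrix.sum_mul, Finset.sum_eq_single c]
  · rw [Matrix.mul_assoc, leg_conjTranspose_mul_leg, Matrix.mul_one]
  · intro d _ hd
    rw [Matrix.mul_assoc, leg_conjTranspose_mul_leg_of_ne e hd, Matrix.mul_zero]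
  · simp

end Legs

/-! ### Embeddings and partial traces as sums over legs -/

section Embedding

variable {S T V β : Type*} [Fintype S] [DecidableEq S] [Fintype T] [DecidableEq T]
  [Fintype V] [DecidableEq V] [Fintype β] [DecidableEq β]

open Classical in
/-- A configuration on `T` is a configuration on `S` together with one on the complement. -/
noncomputable def splitEquiv {S T : Type*} (β : Type*) (f : S ↪ T) :
    (T → β) ≃ (S → β) × ({j : T // j ∉ Set.range f} → β) where
  toFun s := (s ∘ f, fun j => s j)
  invFun p j := if h : ∃ i, f i = j then p.1 h.choose else p.2 ⟨j, h⟩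
  left_inv s := by
    funext j
    dsimp only
    split_ifs with h
    · exact congrArg s h.choose_spec
    · rfl
  right_inv p := by
    refine Prod.ext (funext fun i => ?_) (funext fun j => ?_)
    · have h : ∃ i', f i' = f i := ⟨i, rfl⟩
      simp only [Function.comp_apply, dif_pos h]
      exact congrArg p.1 (f.injective h.choose_spec)
    · exact dif_neg (c := ∃ i, f i = (j : T)) j.2

noncomputable instance {S T : Type*} [Fintype T] (f : S ↪ T) :
    Fintype {j : T // j ∉ Set.range f} := Fintype.ofFinite _

theorem embedOp_eq_sum (f : S ↪ T) (M : Op S β) :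
    embedOp f M = ∑ c, leg (splitEquiv β f) c * M * (leg (splitEquiv β f) c)ᴴ := by
  classical
  ext s t
  rw [sum_leg_mul_mul_apply, embedOp, Matrix.of_apply]
  have h : (∀ j ∉ Set.range f, s j = t j) ↔ (splitEquiv β f s).2 = (splitEquiv β f t).2 :=
    ⟨fun h => funext fun j => h j j.2, fun h j hj => congrFun h ⟨j, hj⟩⟩
  simp only [h]
  rfl

theorem partialTrace_eq_sum (f : S ↪ T) (ρ : Op T β) :
    partialTrace f ρ = ∑ c, (leg (splitEquiv β f) c)ᴴ * ρ * leg (splitEquiv β f) c := by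
  classical
  ext s t
  rw [Matrix.sum_apply, partialTrace, Matrix.of_apply]
  simp only [mul_leg_apply, leg_conjTranspose_mul_apply]
  have h : ∀ σ τ : T → β, (σ ∘ f = s ∧ τ ∘ f = t ∧ ∀ j ∉ Set.range f, σ j = τ j) ↔
      (splitEquiv β f σ).1 = s ∧ (splitEquiv β f τ).1 = t ∧
        (splitEquiv β f σ).2 = (splitEquiv β f τ).2 := fun σ τ =>
    and_congr Iff.rfl (and_congr Iff.rfl
      ⟨fun h => funext fun j => h j j.2, fun h j hj => congrFun h ⟨j, hj⟩⟩)
  simp only [h]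
  have key : ∀ F : (T → β) → (T → β) → ℂ, (∑ σ, ∑ τ, if (splitEquiv β f σ).1 = s ∧
      (splitEquiv β f τ).1 = t ∧ (splitEquiv β f σ).2 = (splitEquiv β f τ).2 then F σ τ else 0)
      = ∑ c, F ((splitEquiv β f).symm (s, c)) ((splitEquiv β f).symm (t, c)) := by
    intro F
    rw [← (splitEquiv β f).symm.sum_comp, Fintype.sum_prod_type, Finset.sum_eq_single s]
    · refine Finset.sum_congr rfl fun c _ => ?_
      rw [← (splitEquiv β f).symm.sum_comp, Finset.sum_eq_single (t, c)]
      · simp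
      · rintro ⟨t', c'⟩ _ h'
        rw [if_neg]
        simp only [Equiv.apply_symm_apply, true_and]
        rintro ⟨rfl, rfl⟩
        exact h' rfl
      · simp
    · intro s' _ hs'
      refine Finset.sum_eq_zero fun c _ => Finset.sum_eq_zero fun τ _ => if_neg ?_
      simp [hs']
    · simp
  convert key ρ

theorem embedOp_mul_leg (f : S ↪ T) (M : Op S β) (c : {j : T // j ∉ Set.range f} → β) :
    embedOp f M * leg (splitEquiv β f) c = leg (splitEquiv β f) c * M := by
  rw [embedOp_eq_sum, sum_leg_mul_mul_leg]

theorem embedOp_conjTranspose (f : S ↪ T) (M : Op S β) : (embedOp f M)ᴴ = embedOp f Mᴴ := by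
  rw [embedOp_eq_sum, embedOp_eq_sum, Matrix.conjTranspose_sum]
  simp [Matrix.mul_assoc]

theorem leg_conjTranspose_mul_embedOp (f : S ↪ T) (M : Op S β)
    (c : {j : T // j ∉ Set.range f} → β) :
    (leg (splitEquiv β f) c)ᴴ * embedOp f M = M * (leg (splitEquiv β f) c)ᴴ := by
  have := congrArg Matrix.conjTranspose (embedOp_mul_leg f Mᴴ c)
  simpa [embedOp_conjTranspose] using this

theorem embedOp_mul (f : S ↪ T) (M N : Op S β) :
    embedOp f (M * N) = embedOp f M * embedOp f N := by
  rw [embedOp_eq_sum f N, Finset.mul_sum, embedOp_eq_sum]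
  simp only [← Matrix.mul_assoc, embedOp_mul_leg]

theorem embedOp_one (f : S ↪ T) : embedOp f (1 : Op S β) = 1 := by
  rw [embedOp_eq_sum]
  simp only [Matrix.mul_one]
  exact sum_leg_mul_leg_conjTranspose _

theorem embedOp_add (f : S ↪ T) (M N : Op S β) :
    embedOp f (M + N) = embedOp f M + embedOp f N := by
  simp [embedOp_eq_sum, Matrix.mul_add, Matrix.add_mul, Finset.sum_add_distrib]

theorem embedOp_smul (f : S ↪ T) (z : ℂ) (M : Op S β) :
    embedOp f (z • M) = z • embedOp f M := by
  simp [embedOp_eq_sum, Finset.smul_sum]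

theorem embedOp_trans {S T V : Type*} (f : S ↪ T) (g : T ↪ V) (M : Op S β) :
    embedOp g (embedOp f M) = embedOp (f.trans g) M := by
  ext s t
  simp only [embedOp, Matrix.of_apply]
  have h : (∀ j ∉ Set.range (f.trans g), s j = t j) ↔
      (∀ j ∉ Set.range g, s j = t j) ∧ ∀ i ∉ Set.range f, s (g i) = t (g i) := by
    constructor
    · intro h
      refine ⟨fun j hj => h j ?_, fun i hi => h (g i) ?_⟩
      · rintro ⟨i, rfl⟩
        exact hj ⟨f i, rfl⟩
      · rintro ⟨i', hi'⟩
        exact hi ⟨i', g.injective hi'⟩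
    · rintro ⟨h1, h2⟩ j hj
      by_cases hg : j ∈ Set.range g
      · obtain ⟨i, rfl⟩ := hg
        refine h2 i ?_
        rintro ⟨i', rfl⟩
        exact hj ⟨i', rfl⟩
      · exact h1 j hg
  by_cases h1 : ∀ j ∉ Set.range g, s j = t j
  · by_cases h2 : ∀ i ∉ Set.range f, (s ∘ g) i = (t ∘ g) i
    · rw [if_pos h1, if_pos (h.2 ⟨h1, h2⟩), if_pos h2]
      rfl
    · rw [if_pos h1, if_neg fun h' => h2 (h.1 h').2, if_neg h2]
  · rw [if_neg h1, if_neg fun h' => h1 (h.1 h').1]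

/-- Duality between partial trace and embedding. It reduces identities of reduced states to
identities of observables. -/
theorem trace_partialTrace_mul (f : S ↪ T) (ρ : Op T β) (M : Op S β) :
    (partialTrace f ρ * M).trace = (ρ * embedOp f M).trace := by
  rw [partialTrace_eq_sum, embedOp_eq_sum, Finset.sum_mul, Finset.mul_sum, Matrix.trace_sum,
    Matrix.trace_sum]
  refine Finset.sum_congr rfl fun c _ => ?_
  rw [Matrix.mul_assoc, Matrix.mul_assoc, Matrix.trace_mul_comm]
  simp only [Matrix.mul_assoc]

theorem partialTrace_trans (f : S ↪ T) (g : T ↪ V) (ρ : Op V β) :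
    partialTrace f (partialTrace g ρ) = partialTrace (f.trans g) ρ := by
  rw [Matrix.ext_iff_trace_mul_right]
  intro M
  rw [trace_partialTrace_mul, trace_partialTrace_mul, trace_partialTrace_mul, embedOp_trans]

theorem partialTrace_conj_embedOp (f : S ↪ T) (ρ : Op T β) (M : Op S β) :
    partialTrace f (embedOp f M * ρ * (embedOp f M)ᴴ) = M * partialTrace f ρ * Mᴴ := by
  rw [partialTrace_eq_sum, partialTrace_eq_sum, Finset.mul_sum, Finset.sum_mul]
  refine Finset.sum_congr rfl fun c _ => ?_
  rw [embedOp_conjTranspose, Matrix.mul_assoc _ _ (leg _ c), Matrix.mul_assoc _ _ (leg _ c),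
    embedOp_mul_leg]
  simp only [← Matrix.mul_assoc, leg_conjTranspose_mul_embedOp]

theorem partialTrace_leg_mul (f : S ↪ T) (M : Op S β) (c : {j : T // j ∉ Set.range f} → β) :
    partialTrace f (leg (splitEquiv β f) c * M * (leg (splitEquiv β f) c)ᴴ) = M := by
  rw [partialTrace_eq_sum, Finset.sum_eq_single c]
  · simp only [Matrix.mul_assoc, leg_conjTranspose_mul_leg, Matrix.mul_one]
    rw [← Matrix.mul_assoc, leg_conjTranspose_mul_leg, Matrix.one_mul]
  · intro d _ hd
    rw [Matrix.mul_assoc, Matrix.mul_assoc, Matrix.mul_assoc,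
      leg_conjTranspose_mul_leg_of_ne _ hd.symm]
    simp
  · simp

theorem partialTrace_sum {ι : Type*} [Fintype ι] (f : S ↪ T) (X : ι → Op T β) :
    partialTrace f (∑ i, X i) = ∑ i, partialTrace f (X i) := by
  simp only [partialTrace_eq_sum, Matrix.mul_sum, Matrix.sum_mul]
  exact Finset.sum_comm

theorem partialTrace_posSemidef (f : S ↪ T) {ρ : Op T β} (h : ρ.PosSemidef) :
    (partialTrace f ρ).PosSemidef := by
  rw [partialTrace_eq_sum]
  exact Matrix.posSemidef_sum _ fun c _ => h.conjTranspose_mul_mul_same _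

theorem partialTrace_sub (f : S ↪ T) (ρ σ : Op T β) :
    partialTrace f (ρ - σ) = partialTrace f ρ - partialTrace f σ := by
  simp [partialTrace_eq_sum, Matrix.mul_sub, Matrix.sub_mul]

theorem fidelity_le_partialTrace (f : S ↪ T) {ρ σ : Op T β} (hρ : ρ.PosSemidef)
    (hσ : σ.PosSemidef) :
    fidelity ρ σ ≤ fidelity (partialTrace f ρ) (partialTrace f σ) := by
  classical
  rw [partialTrace_eq_sum, partialTrace_eq_sum]
  have := fidelity_le_kraus hρ hσ (fun c => (leg (splitEquiv β f) c)ᴴ) (by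
    simp only [Matrix.conjTranspose_conjTranspose]
    exact sum_leg_mul_leg_conjTranspose _)
  simpa only [Matrix.conjTranspose_conjTranspose] using this

end Embedding

/-! ### Regions of support and locality -/

section Support

variable {S T β : Type*} [Fintype S] [DecidableEq S] [Fintype T] [DecidableEq T]
  [Fintype β] [DecidableEq β]

theorem splitEquiv_symm_apply_mem (f : S ↪ T) (s : S → β) (c : {j : T // j ∉ Set.range f} → β)
    (i : S) : (splitEquiv β f).symm (s, c) (f i) = s i :=
  congrFun (congrArg Prod.fst ((splitEquiv β f).apply_symm_apply (s, c))) i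

theorem splitEquiv_symm_apply_not_mem (f : S ↪ T) (s : S → β)
    (c : {j : T // j ∉ Set.range f} → β) {j : T} (hj : j ∉ Set.range f) :
    (splitEquiv β f).symm (s, c) j = c ⟨j, hj⟩ :=
  congrFun (congrArg Prod.snd ((splitEquiv β f).apply_symm_apply (s, c))) ⟨j, hj⟩

/-- Operators on disjoint regions commute. -/
theorem embedOp_commute {S' : Type*} [Fintype S'] [DecidableEq S'] (f : S ↪ T) (g : S' ↪ T)
    (h : ∀ i j, f i ≠ g j) (M : Op S β) (N : Op S' β) :
    embedOp f M * embedOp g N = embedOp g N * embedOp f M := by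
  classical
  have hg : ∀ j, g j ∉ Set.range f := by
    rintro j ⟨i, hi⟩
    exact h i j hi
  -- Seen from the first region, every block of `N` is a scalar. Both products therefore have the
  -- same expansion with coefficients `y c d`.
  have key : ∀ c d, ∃ y : ℂ, (leg (splitEquiv β f) c)ᴴ * embedOp g N * leg (splitEquiv β f) d
      = y • (1 : Op S β) := by
    intro c d
    refine ⟨if ∀ j (hj : j ∉ Set.range f), j ∉ Set.range g → c ⟨j, hj⟩ = d ⟨j, hj⟩ then
      N (fun j => c ⟨g j, hg j⟩) (fun j => d ⟨g j, hg j⟩) else 0, ?_⟩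
    ext s t
    rw [mul_leg_apply, leg_conjTranspose_mul_apply, embedOp, Matrix.of_apply, Matrix.smul_apply,
      Matrix.one_apply, smul_eq_mul, mul_ite, mul_one, mul_zero]
    have e1 : ∀ (s : S → β) c, (splitEquiv β f).symm (s, c) ∘ g = fun j => c ⟨g j, hg j⟩ :=
      fun s c => funext fun j => splitEquiv_symm_apply_not_mem f s c (hg j)
    have e2 : (∀ j ∉ Set.range g, (splitEquiv β f).symm (s, c) j = (splitEquiv β f).symm (t, d) j)
        ↔ s = t ∧ ∀ j (hj : j ∉ Set.range f), j ∉ Set.range g → c ⟨j, hj⟩ = d ⟨j, hj⟩ := by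
      constructor
      · intro H
        refine ⟨funext fun i => ?_, fun j hj hjg => ?_⟩
        · have := H (f i) (by rintro ⟨j, hj⟩; exact h i j hj.symm)
          rwa [splitEquiv_symm_apply_mem, splitEquiv_symm_apply_mem] at this
        · have := H j hjg
          rwa [splitEquiv_symm_apply_not_mem f s c hj,
            splitEquiv_symm_apply_not_mem f t d hj] at this
      · rintro ⟨rfl, H⟩ j hjg
        by_cases hj : j ∈ Set.range f
        · obtain ⟨i, rfl⟩ := hj
          rw [splitEquiv_symm_apply_mem, splitEquiv_symm_apply_mem]
        · rw [splitEquiv_symm_apply_not_mem f s c hj, splitEquiv_symm_apply_not_mem f s d hj]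
          exact H j hj hjg
    simp only [e1, e2, ite_and]
  choose y hy using key
  have h1 := sum_leg_mul_leg_conjTranspose (splitEquiv β f)
  have hl : embedOp f M * embedOp g N = ∑ c, ∑ d,
      y c d • (leg (splitEquiv β f) c * M * (leg (splitEquiv β f) d)ᴴ) := by
    rw [← Matrix.mul_one (embedOp g N), ← h1, embedOp_eq_sum f M, Matrix.sum_mul]
    refine Finset.sum_congr rfl fun c _ => ?_
    rw [Matrix.mul_sum, Matrix.mul_sum]
    refine Finset.sum_congr rfl fun d _ => ?_
    have : leg (splitEquiv β f) c * M * (leg (splitEquiv β f) c)ᴴ *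
        (embedOp g N * (leg (splitEquiv β f) d * (leg (splitEquiv β f) d)ᴴ)) =
        leg (splitEquiv β f) c * M * ((leg (splitEquiv β f) c)ᴴ * embedOp g N *
          leg (splitEquiv β f) d) * (leg (splitEquiv β f) d)ᴴ := by
      simp only [Matrix.mul_assoc]
    rw [this, hy]
    simp
  have hr : embedOp g N * embedOp f M = ∑ d, ∑ c,
      y c d • (leg (splitEquiv β f) c * M * (leg (splitEquiv β f) d)ᴴ) := by
    rw [← Matrix.one_mul (embedOp g N), ← h1, embedOp_eq_sum f M, Matrix.mul_sum]
    refine Finset.sum_congr rfl fun d _ => ?_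
    rw [Matrix.sum_mul, Matrix.sum_mul]
    refine Finset.sum_congr rfl fun c _ => ?_
    have : leg (splitEquiv β f) c * (leg (splitEquiv β f) c)ᴴ * embedOp g N *
        (leg (splitEquiv β f) d * M * (leg (splitEquiv β f) d)ᴴ) =
        leg (splitEquiv β f) c * ((leg (splitEquiv β f) c)ᴴ * embedOp g N *
          leg (splitEquiv β f) d) * M * (leg (splitEquiv β f) d)ᴴ := by
      simp only [Matrix.mul_assoc]
    rw [this, hy]
    simp
  rw [hl, hr, Finset.sum_comm]

/-- `M` acts as the identity outside the region `A`. -/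
def SupportedOn (A : Finset T) (M : Op T β) : Prop :=
  ∃ X : Op A β, embedOp (Function.Embedding.subtype (· ∈ A)) X = M

theorem SupportedOn.mono {A B : Finset T} {M : Op T β} (h : SupportedOn A M) (hAB : A ⊆ B) :
    SupportedOn B M := by
  obtain ⟨X, rfl⟩ := h
  exact ⟨embedOp (Subtype.impEmbedding (· ∈ A) (· ∈ B) fun _ hx => hAB hx) X,
    embedOp_trans _ _ X⟩

theorem SupportedOn.mul {A : Finset T} {M N : Op T β} (hM : SupportedOn A M)
    (hN : SupportedOn A N) : SupportedOn A (M * N) := by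
  obtain ⟨X, rfl⟩ := hM
  obtain ⟨Y, rfl⟩ := hN
  exact ⟨X * Y, embedOp_mul _ X Y⟩

theorem SupportedOn.conjTranspose {A : Finset T} {M : Op T β} (hM : SupportedOn A M) :
    SupportedOn A Mᴴ := by
  obtain ⟨X, rfl⟩ := hM
  exact ⟨Xᴴ, (embedOp_conjTranspose _ X).symm⟩

theorem SupportedOn.commute {A B : Finset T} {M N : Op T β} (hM : SupportedOn A M)
    (hN : SupportedOn B N) (h : Disjoint A B) : M * N = N * M := by
  obtain ⟨X, rfl⟩ := hM
  obtain ⟨Y, rfl⟩ := hN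
  exact embedOp_commute _ _ (fun i j hij => Finset.disjoint_left.1 h i.2 (by
    rw [show (i : T) = j from hij]; exact j.2)) X Y

end Support

/-! ### Light cones of layers and circuits -/

section LightCone

variable {Λ β : Type*} [Fintype Λ] [DecidableEq Λ] [Fintype β] [DecidableEq β]

/-- The operator of a gate on the whole system. -/
noncomputable def Gate.globalOp (a : Gate Λ β) : Op Λ β :=
  embedOp (Function.Embedding.subtype (· ∈ a.support)) a.op

theorem Gate.globalOp_supportedOn (a : Gate Λ β) : SupportedOn a.support a.globalOp :=
  ⟨a.op, rfl⟩

theorem Gate.globalOp_mul_conjTranspose (a : Gate Λ β) : a.globalOp * a.globalOpᴴ = 1 := by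
  have := a.unitary
  rw [Matrix.mem_unitaryGroup_iff, Matrix.star_eq_conjTranspose] at this
  rw [Gate.globalOp, embedOp_conjTranspose, ← embedOp_mul, this, embedOp_one]

/-- The gate inverse to `a`. -/
noncomputable def Gate.adjoint (a : Gate Λ β) : Gate Λ β where
  support := a.support
  op := a.opᴴ
  unitary := by
    have := a.unitary
    rw [Matrix.mem_unitaryGroup_iff'] at this
    rw [Matrix.mem_unitaryGroup_iff, Matrix.star_eq_conjTranspose,
      Matrix.conjTranspose_conjTranspose]
    exact this

theorem Gate.adjoint_globalOp (a : Gate Λ β) : a.adjoint.globalOp = a.globalOpᴴ :=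
  (embedOp_conjTranspose _ a.op).symm

/-- A gate that misses `A` must cancel against its adjoint even after the later gates of the list
have enlarged the support. Since those gates are disjoint from it, the induction can be run with `B`
minus its support, so `B` has to be general. -/
theorem supportedOn_gates_conj (gates : List (Gate Λ β))
    (hd : gates.Pairwise fun a b => Disjoint a.support b.support) {A B : Finset Λ} (hAB : A ⊆ B)
    (hB : ∀ a ∈ gates, ¬ Disjoint a.support A → a.support ⊆ B) {M : Op Λ β}
    (hM : SupportedOn A M) :
    SupportedOn B ((gates.map Gate.globalOp).prod * M * ((gates.map Gate.globalOp).prod)ᴴ) := by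
  induction gates generalizing B with
  | nil => simpa using hM.mono hAB
  | cons a gates ih =>
    rw [List.pairwise_cons] at hd
    set P := (gates.map Gate.globalOp).prod with hP
    have e : ((a :: gates).map Gate.globalOp).prod * M * (((a :: gates).map Gate.globalOp).prod)ᴴ
        = a.globalOp * (P * M * Pᴴ) * a.globalOpᴴ := by
      rw [List.map_cons, List.prod_cons, Matrix.conjTranspose_mul, ← hP]
      simp only [Matrix.mul_assoc]
    rw [e]
    by_cases ha : Disjoint a.support A
    · have h1 : SupportedOn (B \ a.support) (P * M * Pᴴ) := by
        refine ih hd.2 (Finset.subset_sdiff.2 ⟨hAB, ha.symm⟩) fun b hb hbA => ?_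
        exact Finset.subset_sdiff.2 ⟨hB b (List.mem_cons_of_mem _ hb) hbA, (hd.1 b hb).symm⟩
      rw [a.globalOp_supportedOn.commute h1 Finset.disjoint_sdiff, Matrix.mul_assoc,
        a.globalOp_mul_conjTranspose, Matrix.mul_one]
      exact h1.mono Finset.sdiff_subset
    · have h1 : SupportedOn B (P * M * Pᴴ) :=
        ih hd.2 hAB fun b hb hbA => hB b (List.mem_cons_of_mem _ hb) hbA
      have h2 : SupportedOn B a.globalOp :=
        a.globalOp_supportedOn.mono (hB a List.mem_cons_self ha)
      exact (h2.mul h1).mul h2.conjTranspose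

variable [MetricSpace Λ]

theorem mem_ball {x y : Λ} {R : ℝ} : y ∈ ball x R ↔ dist y x ≤ R := by
  simp [ball]

theorem ball_subset_ball (x : Λ) {R R' : ℝ} (h : R ≤ R') : ball x R ⊆ ball x R' :=
  fun _ hy => mem_ball.2 ((mem_ball.1 hy).trans h)

/-- A gate that meets the ball stays within its own diameter of it. The maximum with `0` keeps the
radius from shrinking when `r` is negative. -/
theorem IsLayer.supportedOn_conj {r : ℝ} {W : Op Λ β} (hW : IsLayer r W) {x : Λ} {ℓ : ℝ}
    {M : Op Λ β} (hM : SupportedOn (ball x ℓ) M) :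
    SupportedOn (ball x (ℓ + max r 0)) (W * M * Wᴴ) := by
  obtain ⟨gates, hd, hr, rfl⟩ := hW
  refine supportedOn_gates_conj gates hd
    (ball_subset_ball x (le_add_of_nonneg_right (le_max_right r 0))) (fun a ha hA y hy => ?_) hM
  obtain ⟨z, hz, hzA⟩ := Finset.not_disjoint_iff.1 hA
  rw [mem_ball] at hzA ⊢
  have h1 := hr a ha y hy z hz
  have h2 := dist_triangle y z x
  have h3 := le_max_left r 0
  linarith

theorem IsLayer.conjTranspose {r : ℝ} {W : Op Λ β} (hW : IsLayer r W) : IsLayer r Wᴴ := by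
  obtain ⟨gates, hd, hr, rfl⟩ := hW
  refine ⟨(gates.map Gate.adjoint).reverse, ?_, ?_, ?_⟩
  · rw [List.pairwise_reverse, List.pairwise_map]
    exact hd.imp fun h => h.symm
  · intro a ha
    rw [List.mem_reverse, List.mem_map] at ha
    obtain ⟨b, hb, rfl⟩ := ha
    exact hr b hb
  · rw [Matrix.conjTranspose_list_prod, List.map_reverse, List.map_map, List.map_map]
    congr 2
    exact List.map_congr_left fun a _ => (a.adjoint_globalOp).symm

theorem IsLayer.mem_unitaryGroup {r : ℝ} {W : Op Λ β} (hW : IsLayer r W) :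
    W ∈ Matrix.unitaryGroup (Λ → β) ℂ := by
  obtain ⟨gates, -, -, rfl⟩ := hW
  refine list_prod_mem fun X hX => ?_
  obtain ⟨a, -, rfl⟩ := List.mem_map.1 hX
  exact Matrix.mem_unitaryGroup_iff.2 a.globalOp_mul_conjTranspose

theorem IsCircuit.mem_unitaryGroup {r : ℝ} {D : ℕ} {U : Op Λ β} (hU : IsCircuit r D U) :
    U ∈ Matrix.unitaryGroup (Λ → β) ℂ := by
  obtain ⟨layers, -, hl, rfl⟩ := hU
  exact list_prod_mem fun W hW => (hl W hW).mem_unitaryGroup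

/-- Both light cones are needed: `U M U†` for pulling output observables back, `U† O U` for carrying
the charged operator forward. -/
theorem IsCircuit.conjTranspose {r : ℝ} {D : ℕ} {U : Op Λ β} (hU : IsCircuit r D U) :
    IsCircuit r D Uᴴ := by
  obtain ⟨layers, hD, hl, rfl⟩ := hU
  refine ⟨(layers.map Matrix.conjTranspose).reverse, by simpa using hD, fun W hW => ?_,
    Matrix.conjTranspose_list_prod _⟩
  rw [List.mem_reverse, List.mem_map] at hW
  obtain ⟨W', hW', rfl⟩ := hW
  exact (hl W' hW').conjTranspose

/-- The light cone of a local circuit. -/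
theorem IsCircuit.supportedOn_conj {r : ℝ} {D : ℕ} {U : Op Λ β} (hU : IsCircuit r D U) {x : Λ}
    {ℓ : ℝ} {M : Op Λ β} (hM : SupportedOn (ball x ℓ) M) :
    SupportedOn (ball x (ℓ + D * max r 0)) (U * M * Uᴴ) := by
  obtain ⟨layers, hD, hl, rfl⟩ := hU
  have key : SupportedOn (ball x (ℓ + layers.length * max r 0))
      (layers.prod * M * layers.prodᴴ) := by
    clear hD
    induction layers with
    | nil => simpa using hM
    | cons W layers ih =>
      have h := (hl W List.mem_cons_self).supportedOn_conj
        (ih fun W' hW' => hl W' (List.mem_cons_of_mem _ hW'))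
      have e1 : ℓ + (W :: layers).length * max r 0 = ℓ + layers.length * max r 0 + max r 0 := by
        push_cast [List.length_cons]
        ring
      have e2 : (W :: layers).prod * M * (W :: layers).prodᴴ =
          W * (layers.prod * M * layers.prodᴴ) * Wᴴ := by
        rw [List.prod_cons, Matrix.conjTranspose_mul]
        simp only [Matrix.mul_assoc]
      rwa [e1, e2]
  refine key.mono (ball_subset_ball x ?_)
  have : (layers.length : ℝ) ≤ D := by exact_mod_cast hD
  gcongr

end LightCone

/-! ### Ancillas and Kraus operators -/

section Ancilla

variable {S T κ α : Type*} [Fintype S] [DecidableEq S] [Fintype T] [DecidableEq T]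
  [Fintype κ] [DecidableEq κ] [Fintype α] [DecidableEq α]

/-- A configuration of sites and ancillas is a configuration of each. -/
def ancillaEquiv (T κ α : Type*) : (T → κ × α) ≃ (T → κ) × (T → α) where
  toFun s := (fun i => (s i).1, fun i => (s i).2)
  invFun p i := (p.1 i, p.2 i)
  left_inv _ := rfl
  right_inv _ := rfl

theorem withAncilla_eq (a₀ : α) (ρ : Op T κ) : withAncilla a₀ ρ =
    leg (ancillaEquiv T κ α) (fun _ => a₀) * ρ * (leg (ancillaEquiv T κ α) fun _ => a₀)ᴴ := by
  ext s t
  rw [mul_leg_conjTranspose_apply, leg_mul_apply, withAncilla, Matrix.of_apply, ← ite_and]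
  have h : (∀ i, (s i).2 = a₀ ∧ (t i).2 = a₀) ↔
      (ancillaEquiv T κ α t).2 = (fun _ => a₀) ∧ (ancillaEquiv T κ α s).2 = fun _ => a₀ := by
    simp only [ancillaEquiv, Equiv.coe_fn_mk, funext_iff, forall_and]
    exact and_comm
  simp only [h]
  rfl

theorem traceAncilla_eq_sum (M : Op T (κ × α)) : traceAncilla M =
    ∑ c, (leg (ancillaEquiv T κ α) c)ᴴ * M * leg (ancillaEquiv T κ α) c := by
  ext s t
  rw [Matrix.sum_apply]
  simp only [mul_leg_apply, leg_conjTranspose_mul_apply]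
  rfl

/-- The tensor product `M ⊗ 1` with the identity on the ancillas. -/
noncomputable def tensorAncilla (α : Type*) [Fintype α] (M : Op T κ) : Op T (κ × α) :=
  ∑ c, leg (ancillaEquiv T κ α) c * M * (leg (ancillaEquiv T κ α) c)ᴴ

theorem tensorAncilla_mul_leg (M : Op T κ) (c : T → α) :
    tensorAncilla α M * leg (ancillaEquiv T κ α) c = leg (ancillaEquiv T κ α) c * M :=
  sum_leg_mul_mul_leg _ M c

theorem tensorAncilla_embedOp (f : S ↪ T) (M : Op S κ) :
    tensorAncilla α (embedOp f M) = embedOp f (tensorAncilla α M) := by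
  ext s t
  have h : ((ancillaEquiv T κ α s).2 = (ancillaEquiv T κ α t).2 ∧
      ∀ j ∉ Set.range f, (ancillaEquiv T κ α s).1 j = (ancillaEquiv T κ α t).1 j) ↔
      (∀ j ∉ Set.range f, s j = t j) ∧
        (ancillaEquiv S κ α (s ∘ f)).2 = (ancillaEquiv S κ α (t ∘ f)).2 := by
    simp only [ancillaEquiv, Equiv.coe_fn_mk, funext_iff, Function.comp_apply]
    constructor
    · rintro ⟨h1, h2⟩
      exact ⟨fun j hj => Prod.ext (h2 j hj) (h1 j), fun i => h1 (f i)⟩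
    · rintro ⟨h1, h2⟩
      refine ⟨fun j => ?_, fun j hj => by rw [h1 j hj]⟩
      by_cases hj : j ∈ Set.range f
      · obtain ⟨i, rfl⟩ := hj
        exact h2 i
      · rw [h1 j hj]
  rw [tensorAncilla, sum_leg_mul_mul_apply]
  simp only [embedOp, tensorAncilla, Matrix.of_apply, sum_leg_mul_mul_apply, ← ite_and]
  by_cases hs : (∀ j ∉ Set.range f, s j = t j) ∧
      (ancillaEquiv S κ α (s ∘ f)).2 = (ancillaEquiv S κ α (t ∘ f)).2
  · rw [if_pos (h.2 hs), if_pos hs]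
    rfl
  · rw [if_neg fun h' => hs (h.1 h'), if_neg hs]

/-- `X` cannot change the ancillas outside `S`, so its ancilla blocks are diagonal in the outer
configuration and are operators on `S`. -/
theorem leg_conjTranspose_mul_embedOp_mul_leg (f : S ↪ T) (X : Op S (κ × α)) (a b : S → α)
    (c d : {j : T // j ∉ Set.range f} → α) :
    (leg (ancillaEquiv T κ α) ((splitEquiv α f).symm (a, c)))ᴴ * embedOp f X *
      leg (ancillaEquiv T κ α) ((splitEquiv α f).symm (b, d)) =
    if c = d then embedOp f ((leg (ancillaEquiv S κ α) a)ᴴ * X * leg (ancillaEquiv S κ α) b)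
      else 0 := by
  have hcomp : ∀ (s : T → κ) a c, (ancillaEquiv T κ α).symm (s, (splitEquiv α f).symm (a, c)) ∘ f
      = (ancillaEquiv S κ α).symm (s ∘ f, a) := fun s a c => funext fun i =>
    Prod.ext rfl (splitEquiv_symm_apply_mem f a c i)
  have hiff : ∀ s t : T → κ, (∀ j ∉ Set.range f,
      (ancillaEquiv T κ α).symm (s, (splitEquiv α f).symm (a, c)) j =
        (ancillaEquiv T κ α).symm (t, (splitEquiv α f).symm (b, d)) j) ↔
      c = d ∧ ∀ j ∉ Set.range f, s j = t j := by
    intro s t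
    constructor
    · intro h
      refine ⟨funext fun j => ?_, fun j hj => congrArg Prod.fst (h j hj)⟩
      have : (splitEquiv α f).symm (a, c) j = (splitEquiv α f).symm (b, d) j :=
        congrArg Prod.snd (h j j.2)
      rwa [splitEquiv_symm_apply_not_mem f a c j.2,
        splitEquiv_symm_apply_not_mem f b d j.2] at this
    · rintro ⟨rfl, h⟩ j hj
      refine Prod.ext (h j hj) ?_
      change (splitEquiv α f).symm (a, c) j = (splitEquiv α f).symm (b, c) j
      rw [splitEquiv_symm_apply_not_mem f a c hj, splitEquiv_symm_apply_not_mem f b c hj]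
  ext s t
  rw [mul_leg_apply, leg_conjTranspose_mul_apply, embedOp, Matrix.of_apply]
  simp only [hcomp, hiff, ite_and]
  split_ifs with h1 h2
  · rw [embedOp, Matrix.of_apply, if_pos h2, mul_leg_apply, leg_conjTranspose_mul_apply]
  · rw [embedOp, Matrix.of_apply, if_neg h2]
  · rfl

/-- Resolution of the identity over all ancillas, of which only the terms with the same outer
configuration survive. The number of terms thus depends on `S` and not on the system size. -/
theorem leg_conjTranspose_mul_embedOp_eq_sum (f : S ↪ T) (X : Op S (κ × α)) (a : S → α)
    (c : {j : T // j ∉ Set.range f} → α) :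
    (leg (ancillaEquiv T κ α) ((splitEquiv α f).symm (a, c)))ᴴ * embedOp f X =
      ∑ b, embedOp f ((leg (ancillaEquiv S κ α) a)ᴴ * X * leg (ancillaEquiv S κ α) b) *
        (leg (ancillaEquiv T κ α) ((splitEquiv α f).symm (b, c)))ᴴ := by
  rw [← Matrix.mul_one (embedOp f X), ← sum_leg_mul_leg_conjTranspose (ancillaEquiv T κ α),
    ← (splitEquiv α f).symm.sum_comp, Fintype.sum_prod_type, Matrix.mul_sum, Matrix.mul_sum]
  refine Finset.sum_congr rfl fun b _ => ?_
  rw [Matrix.mul_sum, Matrix.mul_sum, Finset.sum_eq_single c]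
  · rw [← Matrix.mul_assoc, ← Matrix.mul_assoc, leg_conjTranspose_mul_embedOp_mul_leg, if_pos rfl]
  · intro d _ hd
    rw [← Matrix.mul_assoc, ← Matrix.mul_assoc, leg_conjTranspose_mul_embedOp_mul_leg,
      if_neg hd.symm, Matrix.zero_mul]
  · simp

/-- The Kraus operators `⟨c| U† |a₀⟩` of the channel with Stinespring unitary `U`. -/
noncomputable def krausOp (a₀ : α) (U : Op T (κ × α)) (c : T → α) : Op T κ :=
  (leg (ancillaEquiv T κ α) c)ᴴ * Uᴴ * leg (ancillaEquiv T κ α) fun _ => a₀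

theorem traceAncilla_conj_eq_sum (a₀ : α) (U : Op T (κ × α)) (ρ : Op T κ) :
    traceAncilla (Uᴴ * withAncilla a₀ ρ * U) =
      ∑ c, krausOp a₀ U c * ρ * (krausOp a₀ U c)ᴴ := by
  rw [traceAncilla_eq_sum, withAncilla_eq]
  simp [krausOp, Matrix.mul_assoc]

theorem sum_krausOp (a₀ : α) {U : Op T (κ × α)} (hU : U ∈ Matrix.unitaryGroup (T → κ × α) ℂ) :
    ∑ c, (krausOp a₀ U c)ᴴ * krausOp a₀ U c = 1 := by
  rw [Matrix.mem_unitaryGroup_iff, Matrix.star_eq_conjTranspose] at hU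
  have : ∀ c, (krausOp a₀ U c)ᴴ * krausOp a₀ U c =
      (leg (ancillaEquiv T κ α) fun _ => a₀)ᴴ * U *
        (leg (ancillaEquiv T κ α) c * (leg (ancillaEquiv T κ α) c)ᴴ) *
        (Uᴴ * leg (ancillaEquiv T κ α) fun _ => a₀) := fun c => by
    simp [krausOp, Matrix.mul_assoc]
  simp only [this]
  rw [← Matrix.sum_mul, ← Matrix.mul_sum, sum_leg_mul_leg_conjTranspose, Matrix.mul_one,
    Matrix.mul_assoc, ← Matrix.mul_assoc U, hU, Matrix.one_mul, leg_conjTranspose_mul_leg]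

end Ancilla

/-! ### The on-site symmetry and Kraus representations -/

section Symmetry

variable {S T κ G : Type*} [Fintype S] [DecidableEq S] [Fintype T] [DecidableEq T]
  [Fintype κ] [DecidableEq κ] [Group G]

theorem symmetryOp_conjTranspose_mul (u : T → G →* Matrix.unitaryGroup κ ℂ) (g : G) :
    (symmetryOp u g)ᴴ * symmetryOp u g = 1 := by
  ext s t
  have h1 : ∀ i, ∑ k, star ((u i g : Matrix κ κ ℂ) k (s i)) * (u i g : Matrix κ κ ℂ) k (t i) =
      if s i = t i then 1 else 0 := by
    intro i
    have := Matrix.mem_unitaryGroup_iff'.1 (u i g).2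
    have := congrFun (congrFun this (s i)) (t i)
    rwa [Matrix.mul_apply, Matrix.one_apply] at this
  rw [Matrix.mul_apply]
  simp only [Matrix.conjTranspose_apply, symmetryOp, Matrix.of_apply, star_prod,
    ← Finset.prod_mul_distrib]
  rw [← Fintype.piFinset_univ, ← Finset.prod_univ_sum (fun _ => Finset.univ)
    (fun i k => star ((u i g : Matrix κ κ ℂ) k (s i)) * (u i g : Matrix κ κ ℂ) k (t i))]
  simp only [h1]
  rw [Finset.prod_ite_zero, Matrix.one_apply]
  simp [funext_iff]

theorem symmetryOp_mul_conjTranspose (u : T → G →* Matrix.unitaryGroup κ ℂ) (g : G) :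
    symmetryOp u g * (symmetryOp u g)ᴴ = 1 :=
  mul_eq_one_comm.1 (symmetryOp_conjTranspose_mul u g)

theorem leg_conj_symmetryOp (f : S ↪ T) (u : T → G →* Matrix.unitaryGroup κ ℂ) (g : G)
    (c d : {j : T // j ∉ Set.range f} → κ) :
    (leg (splitEquiv κ f) c)ᴴ * symmetryOp u g * leg (splitEquiv κ f) d =
      (∏ j : {j : T // j ∉ Set.range f}, (u j g : Matrix κ κ ℂ) (c j) (d j)) • symmetryOp (fun i => u (f i)) g := by
  classical
  ext s t
  rw [mul_leg_apply, leg_conjTranspose_mul_apply, Matrix.smul_apply, symmetryOp, symmetryOp,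
    Matrix.of_apply, Matrix.of_apply, smul_eq_mul, mul_comm,
    ← Fintype.prod_subtype_mul_prod_subtype (fun j => j ∈ Set.range f)]
  congr 1
  · have := (Equiv.ofInjective f f.injective).prod_comp fun j =>
      (u j g : Matrix κ κ ℂ) ((splitEquiv κ f).symm (s, c) j) ((splitEquiv κ f).symm (t, d) j)
    simp only [Equiv.ofInjective_apply, splitEquiv_symm_apply_mem] at this
    exact Eq.trans (Finset.prod_congr (Finset.ext fun _ => by simp) fun j _ => rfl) this.symm
  · refine Finset.prod_congr (Finset.ext fun _ => by simp) fun j _ => ?_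
    rw [splitEquiv_symm_apply_not_mem f s c j.2, splitEquiv_symm_apply_not_mem f t d j.2]

/-- The symmetry factorizes and its outer factor cancels. Hence being charged does not depend on the
region on which an operator is viewed. -/
theorem symmetryOp_conj_embedOp (f : S ↪ T) (u : T → G →* Matrix.unitaryGroup κ ℂ) (g : G)
    (M : Op S κ) : symmetryOp u g * embedOp f M * (symmetryOp u g)ᴴ =
      embedOp f (symmetryOp (fun i => u (f i)) g * M * (symmetryOp (fun i => u (f i)) g)ᴴ) := by
  set W := symmetryOp u g with hW
  set w := symmetryOp (fun i => u (f i)) g with hw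
  have h1 := sum_leg_mul_leg_conjTranspose (splitEquiv κ f)
  have key : W * embedOp f M = embedOp f (w * M * wᴴ) * W := by
    have hl : W * embedOp f M = ∑ d, ∑ c, (∏ j : {j : T // j ∉ Set.range f}, (u j g : Matrix κ κ ℂ) (c j) (d j)) •
        (leg (splitEquiv κ f) c * (w * M) * (leg (splitEquiv κ f) d)ᴴ) := by
      rw [← Matrix.one_mul W, ← h1, embedOp_eq_sum, Matrix.mul_sum]
      refine Finset.sum_congr rfl fun d _ => ?_
      rw [Matrix.sum_mul, Matrix.sum_mul]
      refine Finset.sum_congr rfl fun c _ => ?_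
      have : leg (splitEquiv κ f) c * (leg (splitEquiv κ f) c)ᴴ * W *
          (leg (splitEquiv κ f) d * M * (leg (splitEquiv κ f) d)ᴴ) =
          leg (splitEquiv κ f) c * ((leg (splitEquiv κ f) c)ᴴ * W * leg (splitEquiv κ f) d) * M *
            (leg (splitEquiv κ f) d)ᴴ := by
        simp only [Matrix.mul_assoc]
      rw [this, leg_conj_symmetryOp, ← hw]
      simp [Matrix.mul_assoc]
    have hr : embedOp f (w * M * wᴴ) * W = ∑ c, ∑ d, (∏ j : {j : T // j ∉ Set.range f}, (u j g : Matrix κ κ ℂ) (c j) (d j)) •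
        (leg (splitEquiv κ f) c * (w * M) * (leg (splitEquiv κ f) d)ᴴ) := by
      rw [← Matrix.mul_one W, ← h1, embedOp_eq_sum, Matrix.sum_mul]
      refine Finset.sum_congr rfl fun c _ => ?_
      rw [Matrix.mul_sum, Matrix.mul_sum]
      refine Finset.sum_congr rfl fun d _ => ?_
      have : leg (splitEquiv κ f) c * (w * M * wᴴ) * (leg (splitEquiv κ f) c)ᴴ *
          (W * (leg (splitEquiv κ f) d * (leg (splitEquiv κ f) d)ᴴ)) =
          leg (splitEquiv κ f) c * (w * M * wᴴ) *
            ((leg (splitEquiv κ f) c)ᴴ * W * leg (splitEquiv κ f) d) *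
            (leg (splitEquiv κ f) d)ᴴ := by
        simp only [Matrix.mul_assoc]
      rw [this, leg_conj_symmetryOp, ← hw, Matrix.mul_smul, Matrix.smul_mul,
        Matrix.mul_assoc (leg (splitEquiv κ f) c), Matrix.mul_assoc (w * M), hw,
        symmetryOp_conjTranspose_mul, Matrix.mul_one]
    rw [hl, hr, Finset.sum_comm]
  rw [key, Matrix.mul_assoc, hW, symmetryOp_mul_conjTranspose, Matrix.mul_one]

/-- The right-hand side sees the Kraus operators only through the values of the channel at `W Wᴴ`,
`W`, `Wᴴ` and `1`, so it is the same for every Kraus representation. -/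
theorem sum_kraus_commutator {m ι : Type*} [Fintype m] [DecidableEq m] [Fintype ι]
    (K : ι → Matrix m m ℂ) (W : Matrix m m ℂ) :
    ∑ i, (K i * W - W * K i) * (K i * W - W * K i)ᴴ =
      ∑ i, K i * (W * Wᴴ) * (K i)ᴴ - (∑ i, K i * W * (K i)ᴴ) * Wᴴ
        - W * (∑ i, K i * Wᴴ * (K i)ᴴ) + W * (∑ i, K i * 1 * (K i)ᴴ) * Wᴴ := by
  rw [Matrix.sum_mul, Matrix.mul_sum, Matrix.mul_sum, Matrix.sum_mul, ← Finset.sum_sub_distrib,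
    ← Finset.sum_sub_distrib, ← Finset.sum_add_distrib]
  refine Finset.sum_congr rfl fun i _ => ?_
  rw [Matrix.conjTranspose_sub, Matrix.conjTranspose_mul, Matrix.conjTranspose_mul,
    Matrix.mul_one]
  noncomm_ring

/-- If one Kraus representation commutes with `W`, so does every other. -/
theorem kraus_commute {m ι ι' : Type*} [Fintype m] [DecidableEq m] [Fintype ι] [Fintype ι']
    (K : ι → Matrix m m ℂ) (L : ι' → Matrix m m ℂ) (W : Matrix m m ℂ)
    (h : ∀ ρ, ∑ i, K i * ρ * (K i)ᴴ = ∑ i, L i * ρ * (L i)ᴴ) (hK : ∀ i, K i * W = W * K i)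
    (i : ι') : L i * W = W * L i := by
  have h0 : ∑ i, (L i * W - W * L i) * (L i * W - W * L i)ᴴ = 0 := by
    rw [sum_kraus_commutator, ← h, ← h, ← h, ← h, ← sum_kraus_commutator]
    simp [hK]
  have h1 : ∀ i, ((L i * W - W * L i) * (L i * W - W * L i)ᴴ).PosSemidef := fun i =>
    Matrix.posSemidef_self_mul_conjTranspose _
  have h2 := (Finset.sum_eq_zero_iff_of_nonneg
    fun i _ => Matrix.nonneg_iff_posSemidef.2 (h1 i)).1 h0 i (Finset.mem_univ i)
  exact sub_eq_zero.1 (Matrix.self_mul_conjTranspose_eq_zero.1 h2)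

end Symmetry

/-! ### Norm bounds, fixed points and operator Cauchy–Schwarz -/

section Charging

open scoped Matrix.Norms.L2Operator

variable {m n k l ι : Type*} [Fintype m] [DecidableEq m] [Fintype n] [DecidableEq n] [Fintype k]
  [Fintype l] [DecidableEq l] [Fintype ι]

theorem norm_isometry_le {V : Matrix m n ℂ} (hV : Vᴴ * V = 1) : ‖V‖ ≤ 1 := by
  have h := Matrix.l2_opNorm_conjTranspose_mul_self V
  rw [hV] at h
  have h1 : ‖(1 : Matrix n n ℂ)‖ ≤ 1 := by
    rcases isEmpty_or_nonempty n with hn | hn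
    · rw [Subsingleton.elim (1 : Matrix n n ℂ) 0, norm_zero]
      exact zero_le_one
    · exact CStarRing.norm_one.le
  nlinarith [norm_nonneg V]

theorem norm_leg_le (e : m ≃ n × k) (c : k) : ‖leg e c‖ ≤ 1 :=
  norm_isometry_le (leg_conjTranspose_mul_leg e c)

theorem norm_leg_conjTranspose_le (e : m ≃ n × k) (c : k) : ‖(leg e c)ᴴ‖ ≤ 1 := by
  rw [Matrix.l2_opNorm_conjTranspose]
  exact norm_leg_le e c

theorem norm_conj_le {A : Matrix l m ℂ} {B : Matrix n k ℂ} [DecidableEq k] (hA : ‖A‖ ≤ 1)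
    (hB : ‖B‖ ≤ 1) (X : Matrix m n ℂ) : ‖A * X * B‖ ≤ ‖X‖ := by
  have h1 := Matrix.l2_opNorm_mul (A * X) B
  have h2 := Matrix.l2_opNorm_mul A X
  nlinarith [norm_nonneg X, norm_nonneg A, norm_nonneg B, norm_nonneg (A * X)]

/-- `M ↦ M ⊗ 1` is a star homomorphism of C⋆-algebras, hence contractive. -/
theorem norm_sum_leg_le (e : m ≃ n × k) (M : Matrix n n ℂ) :
    ‖∑ c, leg e c * M * (leg e c)ᴴ‖ ≤ ‖M‖ := by
  let φ : Matrix n n ℂ →⋆ₙₐ[ℂ] Matrix m m ℂ :=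
    { toFun := fun M => ∑ c, leg e c * M * (leg e c)ᴴ
      map_smul' := fun z M => by simp [Finset.smul_sum]
      map_zero' := by simp
      map_add' := fun M N => by simp [Matrix.mul_add, Matrix.add_mul, Finset.sum_add_distrib]
      map_mul' := fun M N => by
        rw [Matrix.mul_sum]
        refine Finset.sum_congr rfl fun c _ => ?_
        rw [← Matrix.mul_assoc, ← Matrix.mul_assoc, ← Matrix.mul_assoc, sum_leg_mul_mul_leg]
      map_star' := fun M => by
        simp [Matrix.star_eq_conjTranspose, Matrix.mul_assoc] }
  exact NonUnitalStarAlgHom.norm_apply_le φ M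

/-- The squared Hilbert–Schmidt norm of a family of matrices. -/
noncomputable def hsNormSq (F : ι → Matrix m m ℂ) : ℝ := ∑ i, ((F i)ᴴ * F i).trace.re

theorem hsNormSq_parallelogram (F F' : ι → Matrix m m ℂ) :
    hsNormSq (F + F') + hsNormSq (F - F') = 2 * hsNormSq F + 2 * hsNormSq F' := by
  simp only [hsNormSq, ← Finset.sum_add_distrib, Finset.mul_sum]
  refine Finset.sum_congr rfl fun i _ => ?_
  simp only [Pi.add_apply, Pi.sub_apply, Matrix.conjTranspose_add, Matrix.conjTranspose_sub,
    Matrix.mul_add, Matrix.mul_sub, Matrix.add_mul, Matrix.sub_mul, Matrix.trace_add,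
    Matrix.trace_sub, Complex.add_re, Complex.sub_re]
  ring

theorem hsNormSq_smul (t : ℝ) (F : ι → Matrix m m ℂ) :
    hsNormSq (t • F) = t ^ 2 * hsNormSq F := by
  simp only [hsNormSq, Finset.mul_sum]
  refine Finset.sum_congr rfl fun i _ => ?_
  simp [Matrix.conjTranspose_smul, Matrix.trace_smul]
  ring

theorem eq_zero_of_hsNormSq_le {F : ι → Matrix m m ℂ} (h : hsNormSq F ≤ 0) : F = 0 := by
  have h0 : ∀ i, 0 ≤ ((F i)ᴴ * F i).trace.re := fun i =>
    trace_re_nonneg (Matrix.posSemidef_conjTranspose_mul_self _)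
  have h1 := (Finset.sum_eq_zero_iff_of_nonneg fun i _ => h0 i).1
    (le_antisymm h (Finset.sum_nonneg fun i _ => h0 i))
  funext i
  have h2 : ((F i)ᴴ * F i).trace = 0 := by
    refine Complex.ext (h1 i (Finset.mem_univ i)) ?_
    exact (Complex.le_def.1
      (Matrix.posSemidef_conjTranspose_mul_self (F i)).trace_nonneg).2.symm
  exact Matrix.trace_conjTranspose_mul_self_eq_zero_iff.1 h2

theorem continuous_hsNormSq : Continuous (hsNormSq : (ι → Matrix m m ℂ) → ℝ) := by
  unfold hsNormSq
  refine continuous_finsetSum _ fun i _ => Complex.continuous_re.comp ?_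
  have h1 : Continuous fun F : ι → Matrix m m ℂ => F i := continuous_apply i
  exact (h1.matrix_conjTranspose.matrix_mul h1).matrix_trace

/-- Isometries preserving a compact convex set have a common fixed point. -/
theorem exists_common_fixedPoint {K : Set (ι → Matrix m m ℂ)} (hK : IsCompact K)
    (hconv : Convex ℝ K) (hne : K.Nonempty) :
    ∃ F ∈ K, ∀ T : (ι → Matrix m m ℂ) → ι → Matrix m m ℂ, (∀ F ∈ K, T F ∈ K) →
      (∀ F, hsNormSq (T F) = hsNormSq F) → T F = F := by
  obtain ⟨F, hF, hmin⟩ := hK.exists_isMinOn hne continuous_hsNormSq.continuousOn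
  refine ⟨F, hF, fun T hT hiso => ?_⟩
  -- By the parallelogram law the midpoint would have strictly smaller norm than the minimizer `F`
  -- unless `T F = F`.
  have hmid : (1 / 2 : ℝ) • T F + (1 / 2 : ℝ) • F ∈ K :=
    hconv (hT F hF) hF (by norm_num) (by norm_num) (by norm_num)
  have h1 : hsNormSq F ≤ hsNormSq ((1 / 2 : ℝ) • T F + (1 / 2 : ℝ) • F) := hmin hmid
  have h2 := hsNormSq_parallelogram (T F) F
  rw [← smul_add, hsNormSq_smul] at h1
  rw [hiso] at h2
  refine sub_eq_zero.1 (eq_zero_of_hsNormSq_le ?_)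
  linarith

/-- The operator-norm bound plays two roles: it gives the compactness used for the minimizer, and it
is the normalization required of the output operators. -/
theorem isCompact_unitBall_inter {K : Set (ι → Matrix m m ℂ)} (hK : IsClosed K) :
    IsCompact (K ∩ {F | ∀ i, ‖F i‖ ≤ 1}) := by
  have : ProperSpace (ι → Matrix m m ℂ) := FiniteDimensional.proper ℂ _
  refine Metric.isCompact_of_isClosed_isBounded (hK.inter ?_) ?_
  · simp only [Set.ofPred_forall]
    exact isClosed_iInter fun i => isClosed_le (continuous_norm.comp (continuous_apply i))
      continuous_const
  · refine (Metric.isBounded_closedBall (x := 0) (r := 1)).subset fun F hF => ?_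
    rw [mem_closedBall_zero_iff, pi_norm_le_iff_of_nonneg zero_le_one]
    exact hF.2

/-- Operator Cauchy–Schwarz inequality. -/
theorem posSemidef_card_smul_sum_sub (Y : ι → Matrix m n ℂ) {ρ : Matrix n n ℂ}
    (hρ : ρ.PosSemidef) :
    (Fintype.card ι • ∑ i, Y i * ρ * (Y i)ᴴ - (∑ i, Y i) * ρ * (∑ i, Y i)ᴴ).PosSemidef := by
  -- Twice the defect is the sum over ordered pairs of the conjugates of `ρ` by `Y i - Y j`.
  have h : (2 : ℂ) • (Fintype.card ι • ∑ i, Y i * ρ * (Y i)ᴴ -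
      (∑ i, Y i) * ρ * (∑ i, Y i)ᴴ) = ∑ i, ∑ j, (Y i - Y j) * ρ * (Y i - Y j)ᴴ := by
    have e : ∀ i j, (Y i - Y j) * ρ * (Y i - Y j)ᴴ = Y i * ρ * (Y i)ᴴ + Y j * ρ * (Y j)ᴴ -
        Y i * ρ * (Y j)ᴴ - Y j * ρ * (Y i)ᴴ := fun i j => by
      rw [Matrix.conjTranspose_sub]
      simp only [Matrix.sub_mul, Matrix.mul_sub]
      abel
    have e2 : (∑ i, Y i) * ρ * (∑ i, Y i)ᴴ = ∑ i, ∑ j, Y i * ρ * (Y j)ᴴ := by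
      rw [Matrix.conjTranspose_sum, Matrix.sum_mul, Matrix.sum_mul]
      simp only [Matrix.mul_sum]
    simp only [e, Finset.sum_sub_distrib, Finset.sum_add_distrib]
    rw [Finset.sum_comm (f := fun i j => Y j * ρ * (Y i)ᴴ), ← e2]
    simp only [Finset.sum_const, Finset.card_univ, ← Finset.smul_sum]
    module
  have h2 : (∑ i, ∑ j, (Y i - Y j) * ρ * (Y i - Y j)ᴴ).PosSemidef :=
    Matrix.posSemidef_sum _ fun i _ => Matrix.posSemidef_sum _ fun j _ =>
      hρ.mul_mul_conjTranspose_same _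
  have h3 := h2.smul (show (0 : ℂ) ≤ 2⁻¹ by positivity)
  rwa [← h, smul_smul, inv_mul_cancel₀ two_ne_zero, one_smul] at h3

/-- If the Kraus operators intertwine `O` with the family `F`, the channel output of `O ρ O†` is
dominated by the `F a b`-conjugates of the output of `ρ`. -/
theorem posSemidef_kraus_conj_sub [DecidableEq k] (F : k → k → Matrix m m ℂ)
    (L : k → l → Matrix m m ℂ) (O : Matrix m m ℂ) (h : ∀ a c, ∑ b, F a b * L b c = L a c * O)
    {ρ : Matrix m m ℂ} (hρ : ρ.PosSemidef) :
    (Fintype.card k • ∑ x : k × k, F x.1 x.2 * (∑ y : k × l, L y.1 y.2 * ρ * (L y.1 y.2)ᴴ) *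
      (F x.1 x.2)ᴴ - ∑ y : k × l, L y.1 y.2 * (O * ρ * Oᴴ) * (L y.1 y.2)ᴴ).PosSemidef := by
  have e1 : ∑ y : k × l, L y.1 y.2 * (O * ρ * Oᴴ) * (L y.1 y.2)ᴴ =
      ∑ y : k × l, (∑ b, F y.1 b * L b y.2) * ρ * (∑ b, F y.1 b * L b y.2)ᴴ := by
    refine Finset.sum_congr rfl fun y _ => ?_
    rw [h, Matrix.conjTranspose_mul]
    simp only [Matrix.mul_assoc]
  have h1 : (∑ y : k × l, (Fintype.card k • ∑ b, F y.1 b * L b y.2 * ρ * (F y.1 b * L b y.2)ᴴ -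
      (∑ b, F y.1 b * L b y.2) * ρ * (∑ b, F y.1 b * L b y.2)ᴴ)).PosSemidef :=
    Matrix.posSemidef_sum _ fun y _ => posSemidef_card_smul_sum_sub _ hρ
  -- Cauchy–Schwarz only produces the Kraus terms whose first label is `x.2`. The remaining ones,
  -- added to complete the full channel, are positive.
  have h2 : (∑ x : k × k, ∑ y ∈ Finset.univ.filter (fun y : k × l => y.1 ≠ x.2),
      F x.1 x.2 * (L y.1 y.2 * ρ * (L y.1 y.2)ᴴ) * (F x.1 x.2)ᴴ).PosSemidef :=
    Matrix.posSemidef_sum _ fun x _ => Matrix.posSemidef_sum _ fun y _ =>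
      (hρ.mul_mul_conjTranspose_same _).mul_mul_conjTranspose_same _
  have e2 : ∑ x : k × k, F x.1 x.2 * (∑ y : k × l, L y.1 y.2 * ρ * (L y.1 y.2)ᴴ) *
      (F x.1 x.2)ᴴ = (∑ x : k × k, ∑ y ∈ Finset.univ.filter (fun y : k × l => y.1 ≠ x.2),
      F x.1 x.2 * (L y.1 y.2 * ρ * (L y.1 y.2)ᴴ) * (F x.1 x.2)ᴴ) +
      ∑ y : k × l, ∑ b, F y.1 b * L b y.2 * ρ * (F y.1 b * L b y.2)ᴴ := by
    have e3 : ∑ y : k × l, ∑ b, F y.1 b * L b y.2 * ρ * (F y.1 b * L b y.2)ᴴ =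
        ∑ x : k × k, ∑ y ∈ Finset.univ.filter (fun y : k × l => y.1 = x.2),
          F x.1 x.2 * (L y.1 y.2 * ρ * (L y.1 y.2)ᴴ) * (F x.1 x.2)ᴴ := by
      have e4 : ∀ x : k × k, ∑ y ∈ Finset.univ.filter (fun y : k × l => y.1 = x.2),
          F x.1 x.2 * (L y.1 y.2 * ρ * (L y.1 y.2)ᴴ) * (F x.1 x.2)ᴴ =
          ∑ c, F x.1 x.2 * (L x.2 c * ρ * (L x.2 c)ᴴ) * (F x.1 x.2)ᴴ := by
        intro x
        rw [Finset.sum_filter, Fintype.sum_prod_type, Finset.sum_eq_single x.2]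
        · simp
        · intro b _ hb
          simp [hb]
        · simp
      simp only [e4, Fintype.sum_prod_type]
      refine Finset.sum_congr rfl fun a _ => ?_
      rw [Finset.sum_comm]
      refine Finset.sum_congr rfl fun b _ => Finset.sum_congr rfl fun c _ => ?_
      rw [Matrix.conjTranspose_mul]
      simp only [Matrix.mul_assoc]
    rw [e3, ← Finset.sum_add_distrib]
    refine Finset.sum_congr rfl fun x _ => ?_
    rw [add_comm, Finset.sum_filter_add_sum_filter_not, Matrix.mul_sum, Matrix.sum_mul]
  rw [e1, e2, smul_add, add_sub_assoc]
  rw [Finset.sum_sub_distrib, ← Finset.smul_sum] at h1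
  refine Matrix.PosSemidef.add ?_ h1
  rw [← Nat.cast_smul_eq_nsmul ℂ]
  exact h2.smul (by positivity)

end Charging

/-! ### Local action of the channel on states and on charged operators -/

section SingleSystem

variable {Λ κ α G : Type*} [Fintype Λ] [DecidableEq Λ] [MetricSpace Λ] [Fintype κ]
  [DecidableEq κ] [Fintype α] [DecidableEq α] [Group G]

theorem SupportedOn.tensorAncilla {A : Finset Λ} {M : Op Λ κ} (h : SupportedOn A M) :
    SupportedOn A (tensorAncilla α M) := by
  obtain ⟨X, rfl⟩ := h
  exact ⟨_, (tensorAncilla_embedOp _ X).symm⟩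

theorem SupportedOn.leg_conj {A : Finset Λ} {M : Op Λ (κ × α)} (h : SupportedOn A M)
    (c : Λ → α) :
    SupportedOn A ((leg (ancillaEquiv Λ κ α) c)ᴴ * M * leg (ancillaEquiv Λ κ α) c) := by
  obtain ⟨X, rfl⟩ := h
  have := leg_conjTranspose_mul_embedOp_mul_leg (Function.Embedding.subtype (· ∈ A)) X
    (splitEquiv α (Function.Embedding.subtype (· ∈ A)) c).1
    (splitEquiv α (Function.Embedding.subtype (· ∈ A)) c).1
    (splitEquiv α (Function.Embedding.subtype (· ∈ A)) c).2
    (splitEquiv α (Function.Embedding.subtype (· ∈ A)) c).2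
  rw [if_pos rfl, Prod.mk.eta, Equiv.symm_apply_apply] at this
  exact ⟨_, this.symm⟩

/-- The output of a local channel on a ball only depends on the input on a larger ball. -/
theorem reduced_channel_congr {a₀ : α} {r : ℝ} {D : ℕ} {U : Op Λ (κ × α)} (hU : IsCircuit r D U)
    {x : Λ} {ℓ : ℝ} {X Y : Op Λ κ}
    (h : reduced (ball x (ℓ + D * max r 0)) X = reduced (ball x (ℓ + D * max r 0)) Y) :
    reduced (ball x ℓ) (∑ c, krausOp a₀ U c * X * (krausOp a₀ U c)ᴴ) =
      reduced (ball x ℓ) (∑ c, krausOp a₀ U c * Y * (krausOp a₀ U c)ᴴ) := by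
  rw [Matrix.ext_iff_trace_mul_right]
  intro M
  have hM : SupportedOn (ball x ℓ) (embedOp (Function.Embedding.subtype (· ∈ ball x ℓ)) M) :=
    ⟨M, rfl⟩
  obtain ⟨N, hN⟩ := (hU.supportedOn_conj (hM.tensorAncilla (α := α))).leg_conj fun _ => a₀
  have key : ∀ X : Op Λ κ, (reduced (ball x ℓ)
      (∑ c, krausOp a₀ U c * X * (krausOp a₀ U c)ᴴ) * M).trace =
      (reduced (ball x (ℓ + D * max r 0)) X * N).trace := by
    intro X
    rw [reduced, reduced, trace_partialTrace_mul, trace_partialTrace_mul, hN, tensorAncilla,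
      Finset.sum_mul, Matrix.trace_sum]
    simp only [Matrix.mul_sum, Matrix.sum_mul, Matrix.trace_sum]
    refine Finset.sum_congr rfl fun c _ => ?_
    simp only [krausOp, Matrix.conjTranspose_mul, Matrix.conjTranspose_conjTranspose]
    set J := leg (ancillaEquiv Λ κ α) c
    set J₀ := leg (ancillaEquiv Λ κ α) fun _ => a₀
    set M' := embedOp (Function.Embedding.subtype (· ∈ ball x ℓ)) M
    have e1 : Jᴴ * Uᴴ * J₀ * X * (J₀ᴴ * (U * J)) * M' =
        Jᴴ * Uᴴ * J₀ * (X * J₀ᴴ * U * J * M') := by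
      simp only [Matrix.mul_assoc]
    have e2 : X * (J₀ᴴ * (U * (J * M' * Jᴴ) * Uᴴ) * J₀) =
        X * J₀ᴴ * U * J * M' * (Jᴴ * Uᴴ * J₀) := by
      simp only [Matrix.mul_assoc]
    rw [e1, e2, Matrix.trace_mul_comm]
  rw [key, key, h]

/-- Local monotonicity of the fidelity under a local channel. -/
theorem fidelity_reduced_le_channel [Nonempty κ] {a₀ : α} {r : ℝ} {D : ℕ} {U : Op Λ (κ × α)}
    (hU : IsCircuit r D U) {x : Λ} {ℓ : ℝ} {X Y : Op Λ κ} (hX : X.PosSemidef)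
    (hY : Y.PosSemidef) :
    fidelity (reduced (ball x (ℓ + D * max r 0)) X) (reduced (ball x (ℓ + D * max r 0)) Y) ≤
      fidelity (reduced (ball x ℓ) (∑ c, krausOp a₀ U c * X * (krausOp a₀ U c)ᴴ))
        (reduced (ball x ℓ) (∑ c, krausOp a₀ U c * Y * (krausOp a₀ U c)ᴴ)) := by
  classical
  set A := ball x ℓ
  set P := ball x (ℓ + D * max r 0) with hP
  set f := Function.Embedding.subtype (· ∈ A)
  set g := Function.Embedding.subtype (· ∈ P)
  obtain ⟨k⟩ := ‹Nonempty κ›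
  -- The reduced state is padded outside `P` by a fixed product state. By the light cone the padding
  -- does not affect the output on `A`, so the local evolution is itself a Kraus map.
  set V := leg (splitEquiv κ g) fun _ => k with hV
  let K : ({j : Λ // j ∉ Set.range f} → κ) × (Λ → α) → Matrix (A → κ) (P → κ) ℂ := fun y =>
    (leg (splitEquiv κ f) y.1)ᴴ * krausOp a₀ U y.2 * V
  have hK : ∑ y, (K y)ᴴ * K y = 1 := by
    have e : ∀ y, (K y)ᴴ * K y = Vᴴ * ((krausOp a₀ U y.2)ᴴ *
        (leg (splitEquiv κ f) y.1 * (leg (splitEquiv κ f) y.1)ᴴ) * krausOp a₀ U y.2) * V := by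
      intro y
      simp [K, Matrix.mul_assoc]
    simp only [e]
    rw [← Matrix.sum_mul, ← Matrix.mul_sum, Fintype.sum_prod_type, Finset.sum_comm]
    simp only [← Matrix.sum_mul, ← Matrix.mul_sum, sum_leg_mul_leg_conjTranspose, Matrix.mul_one]
    rw [sum_krausOp a₀ hU.mem_unitaryGroup, Matrix.mul_one, leg_conjTranspose_mul_leg]
  have hΦ : ∀ Z : Op Λ κ, ∑ y, K y * reduced P Z * (K y)ᴴ =
      reduced A (∑ c, krausOp a₀ U c * Z * (krausOp a₀ U c)ᴴ) := by
    intro Z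
    have h1 : reduced P (V * reduced P Z * Vᴴ) = reduced P Z := partialTrace_leg_mul g _ _
    rw [← reduced_channel_congr hU h1]
    change _ = partialTrace f _
    rw [partialTrace_eq_sum, Fintype.sum_prod_type]
    refine Finset.sum_congr rfl fun d _ => ?_
    rw [Matrix.mul_sum, Matrix.sum_mul]
    refine Finset.sum_congr rfl fun c _ => ?_
    simp [K, Matrix.mul_assoc]
  have := fidelity_le_kraus (partialTrace_posSemidef g hX) (partialTrace_posSemidef g hY) K hK
  change _ ≤ fidelity (∑ y, K y * reduced P X * (K y)ᴴ) (∑ y, K y * reduced P Y * (K y)ᴴ) at this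
  rwa [hΦ, hΦ] at this

open scoped Matrix.Norms.L2Operator in
/-- A charged local operator is carried through a strongly symmetric local channel by a family of
charged local operators. -/
theorem exists_charged_family [Nonempty κ] {a₀ : α} {r : ℝ} {D : ℕ} {U : Op Λ (κ × α)}
    (hU : IsCircuit r D U) {u : Λ → G →* Matrix.unitaryGroup κ ℂ} {χ : G →* Circle}
    (hcomm : ∀ c g, krausOp a₀ U c * symmetryOp u g = symmetryOp u g * krausOp a₀ U c)
    {x : Λ} {R : ℝ} {O : Op (ball x R) κ} (hO : IsCharged (fun i : ball x R => u i) χ O)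
    (hn : opNorm O ≤ 1) {B : Finset Λ} (hB : ball x (R + D * max r 0) ⊆ B) {f : B ↪ Λ}
    (hf : f = Function.Embedding.subtype (· ∈ B)) :
    ∃ F : (B → α) → (B → α) → Op B κ, (∀ a b, IsCharged (fun i : B => u i) χ (F a b)) ∧
      (∀ a b, opNorm (F a b) ≤ 1) ∧
      ∀ a c, ∑ b, embedOp f (F a b) * krausOp a₀ U ((splitEquiv α f).symm (b, c)) =
        krausOp a₀ U ((splitEquiv α f).symm (a, c)) *
          embedOp (Function.Embedding.subtype (· ∈ ball x R)) O := by
  set O' := embedOp (Function.Embedding.subtype (· ∈ ball x R)) O with hO'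
  set I := (B → α) × (B → α)
  let K₁ : Set (I → Op B κ) := {F | ∀ a c, ∑ b, embedOp f (F (a, b)) *
    krausOp a₀ U ((splitEquiv α f).symm (b, c)) =
      krausOp a₀ U ((splitEquiv α f).symm (a, c)) * O'}
  set K : Set (I → Op B κ) := K₁ ∩ {F | ∀ i, ‖F i‖ ≤ 1}
  have hUu := hU.mem_unitaryGroup
  have hUU : U * Uᴴ = 1 := Matrix.mem_unitaryGroup_iff.1 hUu
  -- The ancilla blocks of `U†(O ⊗ 1)U` solve the relation, though they need not be charged.
  have hne : K.Nonempty := by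
    have hsupp : SupportedOn (ball x R) O' := ⟨O, rfl⟩
    obtain ⟨X, hX⟩ := (hU.conjTranspose.supportedOn_conj (hsupp.tensorAncilla (α := α))).mono hB
    rw [← hf, Matrix.conjTranspose_conjTranspose] at hX
    have hXn : ‖X‖ ≤ 1 := by
      obtain ⟨k⟩ := ‹Nonempty κ›
      -- Compressing by a leg recovers `X`, so its norm is bounded by that of its global extension;
      -- the outer state `(k, a₀)` is arbitrary.
      have e1 : (leg (splitEquiv (κ × α) f) fun _ => (k, a₀))ᴴ * embedOp f X *
          (leg (splitEquiv (κ × α) f) fun _ => (k, a₀)) = X := by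
        rw [leg_conjTranspose_mul_embedOp, Matrix.mul_assoc, leg_conjTranspose_mul_leg,
          Matrix.mul_one]
      rw [← e1, hX]
      refine (norm_conj_le (norm_leg_conjTranspose_le _ _) (norm_leg_le _ _) _).trans ?_
      refine (norm_conj_le (norm_isometry_le ?_) (norm_isometry_le ?_) _).trans ?_
      · rwa [Matrix.conjTranspose_conjTranspose]
      · exact Matrix.mem_unitaryGroup_iff'.1 hUu
      refine (norm_sum_leg_le _ _).trans ?_
      rw [hO', embedOp_eq_sum]
      exact (norm_sum_leg_le _ _).trans hn
    refine ⟨fun i => (leg (ancillaEquiv B κ α) i.1)ᴴ * X * leg (ancillaEquiv B κ α) i.2,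
      fun a c => ?_, fun i => ?_⟩
    · have h1 := leg_conjTranspose_mul_embedOp_eq_sum f X a c
      simp only [krausOp, ← Matrix.mul_assoc]
      rw [← Matrix.sum_mul, ← Matrix.sum_mul, ← h1, hX]
      simp only [Matrix.mul_assoc]
      rw [← Matrix.mul_assoc U, hUU, Matrix.one_mul, tensorAncilla_mul_leg]
    · exact (norm_conj_le (norm_leg_conjTranspose_le _ _) (norm_leg_le _ _) _).trans hXn
  have hconv : Convex ℝ K := by
    refine Convex.inter ?_ ?_
    · intro F hF F' hF' s t hs ht hst a c
      have e : ∀ b, embedOp f ((s • F + t • F') (a, b)) = (s : ℂ) • embedOp f (F (a, b)) +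
          (t : ℂ) • embedOp f (F' (a, b)) := fun b => by
        rw [← embedOp_smul, ← embedOp_smul, ← embedOp_add]
        simp
      simp only [e, Matrix.add_mul, Matrix.smul_mul, Finset.sum_add_distrib, ← Finset.smul_sum]
      rw [hF a c, hF' a c, ← add_smul, ← Complex.ofReal_add, hst, Complex.ofReal_one, one_smul]
    · intro F hF F' hF' s t hs ht hst i
      calc ‖s • F i + t • F' i‖ ≤ ‖s • F i‖ + ‖t • F' i‖ := norm_add_le _ _
        _ = s * ‖F i‖ + t * ‖F' i‖ := by
          rw [norm_smul, norm_smul, Real.norm_of_nonneg hs, Real.norm_of_nonneg ht]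
        _ ≤ s * 1 + t * 1 := by
          gcongr
          · exact hF i
          · exact hF' i
        _ = 1 := by linarith
  have hclosed : IsClosed K₁ := by
    simp only [K₁, Set.ofPred_forall]
    refine isClosed_iInter fun a => isClosed_iInter fun c => isClosed_eq ?_ continuous_const
    refine continuous_finsetSum _ fun b _ => ?_
    simp only [embedOp_eq_sum]
    have h1 : Continuous fun F : I → Op B κ => F (a, b) := continuous_apply _
    refine Continuous.matrix_mul (continuous_finsetSum _ fun c _ => ?_) continuous_const
    exact (continuous_const.matrix_mul h1).matrix_mul continuous_const
  obtain ⟨F, hF, hfix⟩ := exists_common_fixedPoint (isCompact_unitBall_inter hclosed) hconv hne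
  refine ⟨fun a b => F (a, b), fun a b => ⟨hO.1, fun g => ?_⟩, fun a b => hF.2 (a, b), hF.1⟩
  set w := symmetryOp (fun i : B => u i) g with hw
  set W := symmetryOp u g with hW
  have hww : wᴴ * w = 1 := symmetryOp_conjTranspose_mul _ g
  have hww' : w * wᴴ = 1 := symmetryOp_mul_conjTranspose _ g
  have hWW : Wᴴ * W = 1 := symmetryOp_conjTranspose_mul _ g
  have hWW' : W * Wᴴ = 1 := symmetryOp_mul_conjTranspose _ g
  have hχ : star (χ g : ℂ) * (χ g : ℂ) = 1 := by
    have := Complex.conj_mul' (χ g : ℂ)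
    rw [Circle.norm_coe] at this
    simpa using this
  have hconj : ∀ M : Op B κ, embedOp f (w * M * wᴴ) = W * embedOp f M * Wᴴ := fun M => by
    rw [hW, symmetryOp_conj_embedOp, hw, hf]
    rfl
  have hO'W : W * O' * Wᴴ = (χ g : ℂ) • O' := by
    rw [hW, hO', symmetryOp_conj_embedOp, ← embedOp_smul]
    exact congrArg _ (hO.2 g)
  have hLW : ∀ c, Wᴴ * krausOp a₀ U c = krausOp a₀ U c * Wᴴ := fun c => by
    calc Wᴴ * krausOp a₀ U c = Wᴴ * (krausOp a₀ U c * W) * Wᴴ := by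
          rw [Matrix.mul_assoc, Matrix.mul_assoc, hWW', Matrix.mul_one]
      _ = krausOp a₀ U c * Wᴴ := by
          rw [hcomm, ← Matrix.mul_assoc, hWW, Matrix.one_mul]
  -- The conjugate character compensates the charge of `O`, so the twisted conjugation preserves the
  -- relation; a fixed point has charge exactly `χ`.
  have hT := hfix (fun F i => star (χ g : ℂ) • (w * F i * wᴴ)) (fun F hF => ⟨?_, ?_⟩) ?_
  · have h1 := congrFun hT (a, b)
    change star (χ g : ℂ) • (w * F (a, b) * wᴴ) = F (a, b) at h1
    have h2 := congrArg (fun M => (χ g : ℂ) • M) h1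
    simp only [smul_smul] at h2
    rwa [mul_comm, hχ, one_smul] at h2
  · intro a c
    have e : ∀ b, embedOp f (star (χ g : ℂ) • (w * F (a, b) * wᴴ)) *
        krausOp a₀ U ((splitEquiv α f).symm (b, c)) = star (χ g : ℂ) • (W * (embedOp f (F (a, b)) *
          krausOp a₀ U ((splitEquiv α f).symm (b, c))) * Wᴴ) := fun b => by
      rw [embedOp_smul, hconj, Matrix.smul_mul, Matrix.mul_assoc _ Wᴴ, hLW]
      simp only [Matrix.mul_assoc]
    simp only [e]
    rw [← Finset.smul_sum, ← Matrix.sum_mul, ← Matrix.mul_sum, hF.1 a c, ← Matrix.mul_assoc,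
      ← hcomm, Matrix.mul_assoc, Matrix.mul_assoc, ← Matrix.mul_assoc W, hO'W, Matrix.mul_smul,
      smul_smul, hχ, one_smul]
  · intro i
    rw [norm_smul, norm_star, Circle.norm_coe, one_mul]
    refine (norm_conj_le (norm_isometry_le hww) (norm_isometry_le ?_) _).trans (hF.2 i)
    rwa [Matrix.conjTranspose_conjTranspose]
  · intro F
    refine Finset.sum_congr rfl fun i _ => ?_
    congr 1
    have e : (star (χ g : ℂ) • (w * F i * wᴴ))ᴴ * (star (χ g : ℂ) • (w * F i * wᴴ)) =
        w * ((F i)ᴴ * F i) * wᴴ := by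
      rw [Matrix.conjTranspose_smul, star_star, Matrix.smul_mul, Matrix.mul_smul, smul_smul,
        mul_comm, hχ, one_smul]
      simp only [Matrix.conjTranspose_mul, Matrix.conjTranspose_conjTranspose, Matrix.mul_assoc]
      rw [← Matrix.mul_assoc wᴴ w, hww, Matrix.one_mul]
    rw [e, Matrix.trace_mul_comm, ← Matrix.mul_assoc, hww, Matrix.one_mul]

end SingleSystem

/-! ### From one input correlator to one output operator -/

section Stability

variable {Λ κ α G : Type*} [Fintype Λ] [DecidableEq Λ] [MetricSpace Λ] [Fintype κ]
  [DecidableEq κ] [Fintype α] [DecidableEq α] [Group G]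

theorem embedOp_extendOp {S A : Finset Λ} (h : S ⊆ A) (M : Op S κ) :
    embedOp (Function.Embedding.subtype (· ∈ A)) (extendOp h M) =
      embedOp (Function.Embedding.subtype (· ∈ S)) M :=
  embedOp_trans _ _ M

theorem localFidelity_eq {S A : Finset Λ} (h : S ⊆ A) (M : Op S κ) (ρ : Op Λ κ) :
    localFidelity ρ A (extendOp h M) = fidelity (reduced A ρ)
      (reduced A (embedOp (Function.Embedding.subtype (· ∈ S)) M * ρ *
        (embedOp (Function.Embedding.subtype (· ∈ S)) M)ᴴ)) := by
  rw [localFidelity, ← embedOp_extendOp h]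
  congr 1
  exact (partialTrace_conj_embedOp _ ρ (extendOp h M)).symm

theorem reduced_reduced {A A' : Finset Λ} (h : A ⊆ A') (ρ : Op Λ κ) :
    partialTrace (Subtype.impEmbedding (· ∈ A) (· ∈ A') fun _ hx => h hx) (reduced A' ρ) =
      reduced A ρ :=
  partialTrace_trans _ _ ρ

/-- The local fidelity correlator decreases when the region grows. -/
theorem localFidelity_anti {S A A' : Finset Λ} (h : S ⊆ A) (hA : A ⊆ A') (M : Op S κ)
    {ρ : Op Λ κ} (hρ : ρ.PosSemidef) :
    localFidelity ρ A' (extendOp (h.trans hA) M) ≤ localFidelity ρ A (extendOp h M) := by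
  rw [localFidelity_eq, localFidelity_eq, ← reduced_reduced hA, ← reduced_reduced hA]
  exact fidelity_le_partialTrace _ (partialTrace_posSemidef _ hρ)
    (partialTrace_posSemidef _ (hρ.mul_mul_conjTranspose_same _))

/-- Chain of three bounds: local monotonicity under the channel, domination of `E[OρO†]` by the
conjugates of `E[ρ]`, and subadditivity of the fidelity. -/
theorem localFidelity_le_sum [Nonempty κ] {a₀ : α} {r : ℝ} {D : ℕ} {U : Op Λ (κ × α)}
    (hU : IsCircuit r D U) {x : Λ} {ℓ : ℝ} {S B : Finset Λ} (hS : S ⊆ ball x (ℓ + D * max r 0))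
    (hB : B ⊆ ball x ℓ) (O : Op S κ) (F : (B → α) → (B → α) → Op B κ)
    (hF : ∀ a c, ∑ b, embedOp (Function.Embedding.subtype (· ∈ B)) (F a b) *
        krausOp a₀ U ((splitEquiv α (Function.Embedding.subtype (· ∈ B))).symm (b, c)) =
      krausOp a₀ U ((splitEquiv α (Function.Embedding.subtype (· ∈ B))).symm (a, c)) *
        embedOp (Function.Embedding.subtype (· ∈ S)) O)
    {ρ : Op Λ κ} (hρ : ρ.PosSemidef) :
    localFidelity ρ (ball x (ℓ + D * max r 0)) (extendOp hS O) ≤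
      Fintype.card (B → α) * ∑ y : (B → α) × (B → α),
        localFidelity (∑ c, krausOp a₀ U c * ρ * (krausOp a₀ U c)ᴴ) (ball x ℓ)
          (extendOp hB (F y.1 y.2)) := by
  set σ := ∑ c, krausOp a₀ U c * ρ * (krausOp a₀ U c)ᴴ with hσ
  set f := Function.Embedding.subtype (· ∈ B)
  set O' := embedOp (Function.Embedding.subtype (· ∈ S)) O
  have hσp : σ.PosSemidef := Matrix.posSemidef_sum _ fun c _ => hρ.mul_mul_conjTranspose_same _
  have hsplit : ∀ X : Op Λ κ, ∑ c, krausOp a₀ U c * X * (krausOp a₀ U c)ᴴ =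
      ∑ y : (B → α) × ({j : Λ // j ∉ Set.range f} → α),
        krausOp a₀ U ((splitEquiv α f).symm (y.1, y.2)) * X *
          (krausOp a₀ U ((splitEquiv α f).symm (y.1, y.2)))ᴴ := fun X =>
    ((splitEquiv α f).symm.sum_comp _).symm
  have hdom := posSemidef_kraus_conj_sub (fun a b => embedOp f (F a b))
    (fun a c => krausOp a₀ U ((splitEquiv α f).symm (a, c))) O' hF hρ
  rw [← hsplit, ← hsplit, ← hσ] at hdom
  rw [localFidelity_eq]
  refine (fidelity_reduced_le_channel (a₀ := a₀) hU hρ (hρ.mul_mul_conjTranspose_same _)).trans ?_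
  rw [← hσ]
  have hp : ∀ y : (B → α) × (B → α), (reduced (ball x ℓ) (embedOp f (F y.1 y.2) * σ *
      (embedOp f (F y.1 y.2))ᴴ)).PosSemidef := fun y =>
    partialTrace_posSemidef _ (hσp.mul_mul_conjTranspose_same _)
  have hmono := fidelity_mono (ρ := reduced (ball x ℓ) σ)
    (σ := reduced (ball x ℓ) (∑ c, krausOp a₀ U c * (O' * ρ * O'ᴴ) * (krausOp a₀ U c)ᴴ))
    (τ := Fintype.card (B → α) • ∑ y : (B → α) × (B → α), reduced (ball x ℓ)
      (embedOp f (F y.1 y.2) * σ * (embedOp f (F y.1 y.2))ᴴ)) (by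
      have h1 := partialTrace_posSemidef (Function.Embedding.subtype (· ∈ ball x ℓ)) hdom
      rw [partialTrace_sub] at h1
      convert h1 using 2
      · have h2 := partialTrace_sum (Function.Embedding.subtype (· ∈ ball x ℓ))
          (fun _ : Fin (Fintype.card (B → α)) => ∑ y : (B → α) × (B → α),
            embedOp f (F y.1 y.2) * σ * (embedOp f (F y.1 y.2))ᴴ)
        simp only [Finset.sum_const, Finset.card_univ, Fintype.card_fin] at h2
        rw [h2, partialTrace_sum]
        rfl
      · rfl)
  refine hmono.trans ((fidelity_nsmul_le (Matrix.posSemidef_sum _ fun y _ => hp y) _).trans ?_)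
  refine mul_le_mul_of_nonneg_left ?_ (Nat.cast_nonneg _)
  refine (fidelity_sum_le _ hp).trans (le_of_eq ?_)
  exact Finset.sum_congr rfl fun y _ => (localFidelity_eq hB (F y.1 y.2) σ).symm

/-- Pigeonhole over `N²` terms with a prefactor `N`, which explains the cube; `N₀` makes the bound
uniform in the system. -/
theorem exists_le_of_le_mul_sum {ι : Type*} [Fintype ι] {N₀ N c : ℝ} (hc : 0 < c) (hN : 0 ≤ N)
    (hN₀ : N ≤ N₀) (hι : (Fintype.card ι : ℝ) = N * N) {φ : ι → ℝ} (h : c ≤ N * ∑ i, φ i) :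
    ∃ i, c / N₀ ^ 3 ≤ φ i := by
  by_contra! hlt
  have hNpos : 0 < N := by
    rcases hN.eq_or_lt with h0 | h0
    · rw [← h0, zero_mul] at h
      linarith
    · exact h0
  have hne : Nonempty ι := by
    rw [← Fintype.card_pos_iff, ← Nat.cast_pos (α := ℝ), hι]
    positivity
  have h1 : ∑ i, φ i < ∑ _i : ι, c / N₀ ^ 3 :=
    Finset.sum_lt_sum_of_nonempty Finset.univ_nonempty fun i _ => hlt i
  rw [Finset.sum_const, Finset.card_univ, nsmul_eq_mul, hι] at h1
  have h2 : N ^ 3 ≤ N₀ ^ 3 := pow_le_pow_left₀ hN hN₀ 3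
  have h3 : 0 < N₀ ^ 3 := (pow_pos hNpos 3).trans_le h2
  have h4 : N * (N * N * (c / N₀ ^ 3)) ≤ c := by
    rw [show N * (N * N * (c / N₀ ^ 3)) = c * (N ^ 3 / N₀ ^ 3) by ring]
    have := (div_le_one h3).2 h2
    nlinarith
  have h5 := mul_lt_mul_of_pos_left h1 hNpos
  linarith

/-- One charged operator of the output serves all length scales on which the input is good. -/
theorem exists_charged_output {a₀ : α} {r : ℝ} {D : ℕ} {E : Op Λ κ → Op Λ κ}
    (hE : IsFiniteDepthChannel a₀ r D E) {u : Λ → G →* Matrix.unitaryGroup κ ℂ}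
    (hsymm : IsStronglySymmetric u E) {χ : G →* Circle} {x : Λ} {R R' : ℝ}
    (hR' : R' = R + D * max r 0) {O : Op (ball x R) κ}
    (hO : IsCharged (fun i : ball x R => u i) χ O) (hn : opNorm O ≤ 1) {ρ : Op Λ κ}
    (hρ : IsDensityMatrix ρ) {c N₀ : ℝ} (hc : 0 < c)
    (hN₀ : (Fintype.card (ball x R' → α) : ℝ) ≤ N₀) (n : ℕ) :
    ∃ O' : Op (ball x R') κ, IsCharged (fun i : ball x R' => u i) χ O' ∧ opNorm O' ≤ 1 ∧
      ∀ m ≤ n, R' + D * max r 0 ≤ m →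
        (∀ (A : Finset Λ) (h : ball x R ⊆ A), A ⊆ ball x m →
          c ≤ localFidelity ρ A (extendOp h O)) →
        ∀ (A : Finset Λ) (h : ball x R' ⊆ A), A ⊆ ball x (m - D * max r 0) →
          c / N₀ ^ 3 ≤ localFidelity (E ρ) A (extendOp h O') := by
  classical
  obtain ⟨U, hU, hEU⟩ := hE
  obtain ⟨p, K, hK, hKcomm⟩ := hsymm
  have hE' : ∀ ρ, E ρ = ∑ c, krausOp a₀ U c * ρ * (krausOp a₀ U c)ᴴ := fun ρ => by
    rw [hEU, traceAncilla_conj_eq_sum]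
  have hcomm : ∀ c g, krausOp a₀ U c * symmetryOp u g = symmetryOp u g * krausOp a₀ U c :=
    fun c g => kraus_commute K (krausOp a₀ U) (symmetryOp u g)
      (fun ρ => (hK ρ).symm.trans (hE' ρ)) (fun a => hKcomm a g) c
  -- With an empty local basis there is no configuration at all, as `x` is a site, and the trace
  -- could not be one.
  have hκ : Nonempty κ := by
    by_contra hκ
    rw [not_nonempty_iff] at hκ
    have : IsEmpty (Λ → κ) := ⟨fun s => hκ.elim (s x)⟩
    have h1 := hρ.2
    rw [Matrix.trace, Finset.univ_eq_empty, Finset.sum_empty] at h1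
    exact zero_ne_one h1
  have hEρ : (E ρ).PosSemidef := by
    rw [hE']
    exact Matrix.posSemidef_sum _ fun c _ => hρ.1.mul_mul_conjTranspose_same _
  obtain ⟨F, hFχ, hFn, hF⟩ := exists_charged_family hU hcomm hO hn
    (ball_subset_ball x hR'.ge) (f := Function.Embedding.subtype (· ∈ ball x R')) rfl
  let good : ℕ → Prop := fun m => R' + D * max r 0 ≤ m ∧
    ∀ (A : Finset Λ) (h : ball x R ⊆ A), A ⊆ ball x m → c ≤ localFidelity ρ A (extendOp h O)
  by_cases hex : ∃ m ≤ n, good m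
  -- The operator is selected at the largest good scale up to `n`; every smaller good scale inherits
  -- the bound, since local fidelities decrease in the region.
  · set M := Nat.findGreatest good n with hM
    obtain ⟨m₀, hm₀, hgood₀⟩ := hex
    have hMgood : good M := Nat.findGreatest_spec hm₀ hgood₀
    have hδ : 0 ≤ D * max r 0 := by positivity
    have hcan : (M : ℝ) - D * max r 0 + D * max r 0 = M := sub_add_cancel _ _
    have hB : ball x R' ⊆ ball x (M - D * max r 0) := ball_subset_ball x (by linarith [hMgood.1])
    have hS : ball x R ⊆ ball x (M - D * max r 0 + D * max r 0) :=
      ball_subset_ball x (by linarith [hMgood.1])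
    have h1 := hMgood.2 _ hS (ball_subset_ball x hcan.le)
    have h2 := h1.trans (localFidelity_le_sum hU hS hB O F hF hρ.1)
    rw [← hE'] at h2
    obtain ⟨y, hy⟩ := exists_le_of_le_mul_sum hc (Nat.cast_nonneg _) hN₀
      (by rw [Fintype.card_prod, Nat.cast_mul]) h2
    refine ⟨F y.1 y.2, hFχ _ _, hFn _ _, fun m hm hRm hgood A h hA => hy.trans ?_⟩
    have hmM : m ≤ M := Nat.le_findGreatest hm ⟨hRm, hgood⟩
    have hmM' : (m : ℝ) ≤ M := by exact_mod_cast hmM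
    exact localFidelity_anti h (hA.trans (ball_subset_ball x (by linarith))) _ hEρ
  -- Without a good scale nothing is to be bounded, and any member of the charged family will do.
  · refine ⟨F (fun _ => a₀) fun _ => a₀, hFχ _ _, hFn _ _, fun m hm hRm hgood => ?_⟩
    exact absurd ⟨m, hm, hRm, hgood⟩ hex

end Stability

end LocalSWSSB

/-! ### The thermodynamic limit -/

theorem theorem4
    {κ α G : Type*} [Fintype κ] [DecidableEq κ] [Fintype α] [DecidableEq α] [CommGroup G]
    {Λ : ℕ → Type*} [∀ n, Fintype (Λ n)] [∀ n, DecidableEq (Λ n)] [∀ n, MetricSpace (Λ n)]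
    (hΛ : ∀ ℓ : ℝ, ∃ V : ℕ, ∀ (n : ℕ) (y : Λ n), (LocalSWSSB.ball y ℓ).card ≤ V)
    (u : ∀ n, Λ n → G →* Matrix.unitaryGroup κ ℂ)
    (ρ : ∀ n, LocalSWSSB.Op (Λ n) κ) (hρ : ∀ n, LocalSWSSB.IsDensityMatrix (ρ n))
    (a₀ : α) (r : ℝ) (D : ℕ) (E : ∀ n, LocalSWSSB.Op (Λ n) κ → LocalSWSSB.Op (Λ n) κ)
    (hE : ∀ n, LocalSWSSB.IsFiniteDepthChannel a₀ r D (E n))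
    (hsymm : ∀ n, LocalSWSSB.IsStronglySymmetric (u n) (E n))
    (χ : G →* Circle) (x : ∀ n, Λ n) (hSSB : LocalSWSSB.HasLocalSWSSB u χ x ρ) :
    LocalSWSSB.HasLocalSWSSB u χ x (fun n => E n (ρ n)) := by
  obtain ⟨R, O, hO, hn, c, hc, hgood⟩ := hSSB
  set δ : ℝ := D * max r 0 with hδ
  obtain ⟨V, hV⟩ := hΛ (R + δ)
  have hα : 0 < Fintype.card α := Fintype.card_pos_iff.2 ⟨a₀⟩
  have hN : ∀ n, (Fintype.card (LocalSWSSB.ball (x n) (R + δ) → α) : ℝ) ≤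
      ((Fintype.card α ^ V : ℕ) : ℝ) := fun n => by
    rw [Fintype.card_fun, Fintype.card_coe, Nat.cast_le]
    exact Nat.pow_le_pow_right hα (hV n (x n))
  -- The index `n` itself, as the last argument, is the cutoff on scales; it makes the maximum
  -- finite and eventually exceeds any fixed scale.
  choose O' hO' hn' hloc using fun n => LocalSWSSB.exists_charged_output (hE n) (hsymm n) rfl
    (hO n) (hn n) (hρ n) hc (hN n) n
  have hNpos : (0 : ℝ) < (Fintype.card α ^ V : ℕ) := by exact_mod_cast pow_pos hα V
  refine ⟨R + δ, O', hO', hn', c / ((Fintype.card α ^ V : ℕ) : ℝ) ^ 3, by positivity, fun ℓ => ?_⟩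
  -- The input scale must exceed `ℓ` by one light-cone width and also contain the light cone of the
  -- output operator.
  obtain ⟨m, hm⟩ := exists_nat_ge (max (ℓ + δ) (R + δ + δ))
  filter_upwards [hgood m, Filter.eventually_ge_atTop m] with n hgn hmn A h hA
  refine hloc n m hmn ((le_max_right _ _).trans hm) hgn A h
    (hA.trans (LocalSWSSB.ball_subset_ball (x n) ?_))
  have := (le_max_left _ _).trans hm
  linarith
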